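/- Setting. Let $n$ be a number of degrees of freedom, $\hbar>0$, and let $\mathcal H=L^2(\mathbb R^n)$ carry the Schrödinger representation of the canonical commutation rules, with position vector $\vec Q$ (multiplication by the coordinates), momentum vector $\vec P=-i\hbar\nabla$, their projection valued measures $\mathsf Q,\mathsf P$, the Weyl operators $W(\vec x,\vec p)=\exp\{\frac i\hbar(\vec p\cdot\vec Q-\vec x\cdot\vec P)\}$ and the parity operator $\Pi$, $(\Pi\psi)(\vec y)=\psi(-\vec y)$. Put $\Omega=\begin{pmatrix}0&\hbar 1\\-\hbar 1&0\end{pmatrix}$, identify $W(\vec x,\vec p)$ with $W$ evaluated at the block column vector $(\vec x,\vec p)$, and let $\log=\log_2$. For a state (statistical operator) $\rho$, $\mathsf Q_\rho,\mathsf P_\rho$ are the distributions of position and momentum in $\rho$, with mean vectors $\vec a^\rho,\vec b^\rho$ and variance matrices $A^\rho,B^\rho$. A state $\rho$ is Gaussian if there are $\mu\in\mathbb R^{2n}$ and a real $2n\times 2n$ matrix $V$ with $V+\frac i2\Omega\ge 0$ and $\mathrm{Tr}\{\rho W(-\Omega w)\}=\exp\{i\,w^T\mu-\frac12 w^TVw\}$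 for all $w\in\mathbb R^{2n}$. A covariant phase-space observable is a positive operator valued measure (POVM) $\mathsf M$ on $\mathbb R^n\times\mathbb R^n$ with $W(\vec x,\vec p)\mathsf M(Z)W(\vec x,\vec p)^*=\mathsf M(Z+(\vec x,\vec p))$. A POVM $\mathsf M$ on $\mathbb R^m\times\mathbb R^m$ is Gaussian if $\int e^{i w\cdot z}\,\mathsf M(dz)=W(-\Omega J^Tw)\exp\{i\,w^T\mu-\frac12w^TVw\}$ for all $w\in\mathbb R^{2m}$, for some $\mu\in\mathbb R^{2m}$, some real $2m\times 2n$ matrix $J$ and some real symmetric matrix $V$ with $V\pm\frac i2J\Omega J^T\ge0$. To a state $\sigma$ corresponds the covariant phase-space observable $$\mathsf M^\sigma(B)=\frac1{(2\pi\hbar)^n}\int_B W(\vec x,\vec p)\,\Pi\sigma\Pi\,W(\vec x,\vec p)^*\,d\vec x\,d\vec p .$$ Let $\mathsf M^\sigma_{1,\rho},\mathsf M^\sigma_{2,\rho}$ be the position and momentum marginals of the distribution of $\mathsf M^\sigma$ in the state $\rho$. With $S(p\|q)\in[0,\infty]$ the relative entropy in bits, the error function is $$S(\rho,\mathsf M^\sigma)=S(\mathsf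 Q_\rho\|\mathsf M^\sigma_{1,\rho})+S(\mathsf P_\rho\|\mathsf M^\sigma_{2,\rho}).$$ For $\varepsilon_1,\varepsilon_2>0$ let $\mathcal G_\varepsilon$ be the set of the Gaussian states $\rho$ with $A^\rho\ge\varepsilon_1 1$ and $B^\rho\ge\varepsilon_2 1$, let $D^G_\varepsilon(\mathsf M^\sigma)=\sup_{\rho\in\mathcal G_\varepsilon}S(\rho,\mathsf M^\sigma)$, and let $s(x)=\ln(1+x)-\frac x{1+x}$, applied to symmetric matrices by functional calculus. Theorem. Let $\sigma$ be a state such that $\mathsf M^\sigma$ is a Gaussian covariant phase-space observable, and let $\varepsilon_1,\varepsilon_2>0$. (i) If $\varepsilon_1\varepsilon_2\ge\hbar^2/4$, then there are Gaussian states $\rho$ with $A^{\rho}=\varepsilon_1 1$ and $B^{\rho}=\varepsilon_2 1$, and every such $\rho$ belongs to $\mathcal G_\varepsilon$ and satisfies $$D^G_\varepsilon(\mathsf M^\sigma)=S(\rho,\mathsf M^\sigma)=\frac{\log e}2\Bigl[\mathrm{Tr}\{s(A^\sigma/\varepsilon_1)+s(B^\sigma/\varepsilon_2)\}+\vec a^\sigma\cdot(A^\sigma+\varepsilon_11)^{-1}\vec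 a^\sigma+\vec b^\sigma\cdot(B^\sigma+\varepsilon_21)^{-1}\vec b^\sigma\Bigr].$$ (ii) If $\varepsilon_1\varepsilon_2<\hbar^2/4$, then there are Gaussian states $\rho$ with $A^{\rho}=\varepsilon_1 1$ and $B^{\rho}=\frac{\hbar^2}{4\varepsilon_1}1$, and every such $\rho$ belongs to $\mathcal G_\varepsilon$ and satisfies $$D^G_\varepsilon(\mathsf M^\sigma)\ge S(\rho,\mathsf M^\sigma)=\frac{\log e}2\Bigl[\mathrm{Tr}\bigl\{s(A^\sigma/\varepsilon_1)+s(4\varepsilon_1B^\sigma/\hbar^2)\bigr\}+\vec a^\sigma\cdot(A^\sigma+\varepsilon_11)^{-1}\vec a^\sigma+\vec b^\sigma\cdot\Bigl(B^\sigma+\tfrac{\hbar^2}{4\varepsilon_1}1\Bigr)^{-1}\vec b^\sigma\Bigr].$$ -/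

import Mathlib

open MeasureTheory Matrix
open scoped ENNReal ComplexOrder

noncomputable section

namespace EntropicMUR

/-! ### Hilbert space, trace, states -/

/-- The configuration space `ℝⁿ`. -/
abbrev Vec (n : ℕ) : Type := EuclideanSpace ℝ (Fin n)

/-- The Hilbert space `L²(ℝⁿ; ℂ)`, carrying the Schrödinger representation of the canonical
commutation rules. -/
abbrev Hil (n : ℕ) : Type := Lp ℂ 2 (volume : Measure (Vec n))

/-- Bounded operators on `Hil n`. -/
abbrev Op (n : ℕ) : Type := Hil n →L[ℂ] Hil n

/-- The index set of a fixed orthonormal (Hilbert) basis of `Hil n`. -/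
def basisIndex (n : ℕ) : Set (Hil n) := (exists_hilbertBasis ℂ (Hil n)).choose

/-- A fixed orthonormal (Hilbert) basis of `Hil n`. -/
def basis (n : ℕ) : HilbertBasis (basisIndex n) ℂ (Hil n) :=
  (exists_hilbertBasis ℂ (Hil n)).choose_spec.choose

/-- The trace `∑ᵢ ⟨eᵢ, T eᵢ⟩`; it is used only for trace class operators, for which the series
converges absolutely and its sum does not depend on the orthonormal basis. -/
def opTrace {n : ℕ} (T : Op n) : ℂ := ∑' i, inner ℂ (basis n i) (T (basis n i))

/-- States (statistical operators): positive operators of trace one. -/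
def IsState {n : ℕ} (ρ : Op n) : Prop :=
  ρ.IsPositive ∧ HasSum (fun i => inner ℂ (basis n i) (ρ (basis n i))) 1

/-! ### Multiplication operators, Weyl operators, parity -/

/-- The operator of multiplication by the essentially bounded function `f`. -/
def mulOp {n : ℕ} (f : Vec n → ℂ) (hf : MemLp f ∞ (volume : Measure (Vec n))) : Op n :=
  (ContinuousLinearMap.mul ℂ ℂ).holderL volume ∞ 2 2 (hf.toLp f)

/-- The translation `ψ ↦ ψ(· - x)`, that is `exp(-(i/ħ) x·P)`. -/
def translation {n : ℕ} (x : Vec n) : Op n :=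
  (Lp.compMeasurePreservingₗᵢ ℂ (fun y : Vec n => y - x)
    (measurePreserving_sub_right volume x)).toContinuousLinearMap

/-- The multiplier `y ↦ exp((i/ħ)(p·y - x·p/2))`. -/
def weylPhase {n : ℕ} (hbar : ℝ) (x p : Vec n) (y : Vec n) : ℂ :=
  Complex.exp (((hbar⁻¹ * (inner ℝ p y - inner ℝ x p / 2) : ℝ) : ℂ) * Complex.I)

lemma memLp_weylPhase {n : ℕ} (hbar : ℝ) (x p : Vec n) :
    MemLp (weylPhase hbar x p) ∞ (volume : Measure (Vec n)) := by
  refine memLp_top_of_bound (C := 1) ?_ (Filter.Eventually.of_forall fun y => ?_)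
  · refine Continuous.aestronglyMeasurable ?_
    unfold weylPhase
    fun_prop
  · rw [weylPhase, Complex.norm_exp_ofReal_mul_I]

/-- The Weyl operator
`W(x,p) = exp((i/ħ)(p·Q - x·P)) = exp((i/ħ)p·Q) exp(-(i/ħ)x·P) exp(-(i/2ħ)x·p)`. -/
def weyl {n : ℕ} (hbar : ℝ) (x p : Vec n) : Op n :=
  (mulOp (weylPhase hbar x p) (memLp_weylPhase hbar x p)).comp (translation x)

/-- The parity operator `ψ ↦ ψ(-·)`. -/
def parity (n : ℕ) : Op n :=
  (Lp.compMeasurePreservingₗᵢ ℂ (fun y : Vec n => -y)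
    (Measure.measurePreserving_neg volume)).toContinuousLinearMap

/-! ### Operator valued measures and outcome distributions -/

/-- Operator valued set functions; only the values on measurable sets matter. -/
abbrev OpMeasure (n : ℕ) (Z : Type) : Type := Set Z → Op n

/-- Positive operator valued measures. -/
structure IsPOVM {n : ℕ} {Z : Type} [MeasurableSpace Z] (M : OpMeasure n Z) : Prop where
  isPositive : ∀ B, MeasurableSet B → (M B).IsPositive
  univ_eq : M Set.univ = 1
  hasSum : ∀ B : ℕ → Set Z, (∀ i, MeasurableSet (B i)) → Pairwise (Function.onFun Disjoint B) →
    ∀ φ ψ : Hil n, HasSum (fun i => inner ℂ φ (M (B i) ψ)) (inner ℂ φ (M (⋃ i, B i) ψ))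

open Classical in
/-- The measure with the values `m B` on the measurable sets `B` (unique if it exists, which is
the case whenever `m` is countably additive; the default is `0`). -/
def measureOf {Z : Type} [MeasurableSpace Z] (m : Set Z → ℝ≥0∞) : Measure Z :=
  if h : ∃ μ : Measure Z, ∀ B, MeasurableSet B → μ B = m B then h.choose else 0

/-- The distribution `M_ρ(B) = Tr{ρ M(B)}` of the outcomes of `M` in the state `ρ`. -/
def law {n : ℕ} {Z : Type} [MeasurableSpace Z] (M : OpMeasure n Z) (ρ : Op n) : Measure Z :=
  measureOf fun B => ENNReal.ofReal (opTrace (ρ.comp (M B))).re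

/-- The positive measure `B ↦ ⟨ψ, M(B) ψ⟩`. -/
def vectorLaw {n : ℕ} {Z : Type} [MeasurableSpace Z] (M : OpMeasure n Z) (ψ : Hil n) :
    Measure Z :=
  measureOf fun B => ENNReal.ofReal (inner ℂ ψ (M B ψ)).re

/-- `T = ∫ f(z) M(dz)`, in the sense that `⟨ψ, T ψ⟩ = ∫ f(z) ⟨ψ, M(dz) ψ⟩` for all `ψ`
(by polarization this determines `T`). -/
def HasOpIntegral {n : ℕ} {Z : Type} [MeasurableSpace Z] (M : OpMeasure n Z) (f : Z → ℂ)
    (T : Op n) : Prop :=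
  ∀ ψ : Hil n, Integrable f (vectorLaw M ψ) ∧ inner ℂ ψ (T ψ) = ∫ z, f z ∂(vectorLaw M ψ)

open Classical in
/-- The integral `∫ F(z) μ(dz)` in the weak operator topology (the default is `0`). -/
def weakIntegral {n : ℕ} {Z : Type} [MeasurableSpace Z] (μ : Measure Z) (F : Z → Op n) : Op n :=
  if h : ∃ T : Op n, ∀ φ ψ : Hil n, Integrable (fun z => inner ℂ φ (F z ψ)) μ ∧
      inner ℂ φ (T ψ) = ∫ z, inner ℂ φ (F z ψ) ∂μ
  then h.choose else 0

/-! ### Sharp position and momentum -/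

lemma memLp_indicator_one {n : ℕ} {A : Set (Vec n)} (hA : MeasurableSet A) :
    MemLp (A.indicator fun _ => (1 : ℂ)) ∞ (volume : Measure (Vec n)) :=
  (memLp_top_const (1 : ℂ)).indicator hA

open Classical in
/-- The projection valued measure of the position vector: `Q(A)` is the multiplication by the
indicator function of `A`. -/
def positionPVM (n : ℕ) : OpMeasure n (Vec n) := fun A =>
  if hA : MeasurableSet A then mulOp (A.indicator fun _ => 1) (memLp_indicator_one hA) else 0

/-- The projection valued measure of the momentum vector `P = -iħ∇`. With the Fourier transform
`(ℱψ)(w) = ∫ exp(-2πi w·y) ψ(y) dy`, the operator `ℱ P ℱ⁻¹` is the multiplication by `2πħw`. -/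
def momentumPVM (hbar : ℝ) (n : ℕ) : OpMeasure n (Vec n) := fun B =>
  ((Lp.fourierTransformₗᵢ (Vec n) ℂ).symm.toContinuousLinearEquiv.toContinuousLinearMap.comp
    (positionPVM n {w | (2 * Real.pi * hbar) • w ∈ B})).comp
      (Lp.fourierTransformₗᵢ (Vec n) ℂ).toContinuousLinearEquiv.toContinuousLinearMap

/-- The mean vector of a distribution on `ℝⁿ`. -/
def meanVec {n : ℕ} (μ : Measure (Vec n)) : Fin n → ℝ := fun i => ∫ x, x i ∂μ

/-- The variance matrix of a distribution on `ℝⁿ`. -/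
def varMat {n : ℕ} (μ : Measure (Vec n)) : Matrix (Fin n) (Fin n) ℝ :=
  Matrix.of fun i j => ∫ x, (x i - meanVec μ i) * (x j - meanVec μ j) ∂μ

/-- The position mean vector `a^ρ`. -/
def posMean {n : ℕ} (ρ : Op n) : Fin n → ℝ := meanVec (law (positionPVM n) ρ)

/-- The position variance matrix `A^ρ`. -/
def posVar {n : ℕ} (ρ : Op n) : Matrix (Fin n) (Fin n) ℝ := varMat (law (positionPVM n) ρ)

/-- The momentum mean vector `b^ρ`. -/
def momMean {n : ℕ} (hbar : ℝ) (ρ : Op n) : Fin n → ℝ := meanVec (law (momentumPVM hbar n) ρ)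

/-- The momentum variance matrix `B^ρ`. -/
def momVar {n : ℕ} (hbar : ℝ) (ρ : Op n) : Matrix (Fin n) (Fin n) ℝ :=
  varMat (law (momentumPVM hbar n) ρ)

/-! ### Phase-space vectors, Gaussian states -/

/-- Column vectors in `ℝ²ᵐ`, made of two blocks in `ℝᵐ`. -/
abbrev PhaseVec (m : ℕ) : Type := Fin m ⊕ Fin m → ℝ

/-- Real `2m × 2n` block matrices. -/
abbrev PhaseMat (m n : ℕ) : Type := Matrix (Fin m ⊕ Fin m) (Fin n ⊕ Fin n) ℝ

/-- The block column vector with blocks `x` and `p`. -/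
def stack {m : ℕ} (z : Vec m × Vec m) : PhaseVec m := Sum.elim z.1 z.2

/-- The Weyl operator of a block column vector. -/
def weylVec {n : ℕ} (hbar : ℝ) (z : PhaseVec n) : Op n :=
  weyl hbar (WithLp.toLp 2 fun i => z (Sum.inl i)) (WithLp.toLp 2 fun i => z (Sum.inr i))

/-- The matrix `Ω = (0, ħ1; -ħ1, 0)`. -/
def Omega (hbar : ℝ) (n : ℕ) : PhaseMat n n :=
  Matrix.fromBlocks 0 (hbar • 1) (-(hbar • 1)) 0

/-- The function `w ↦ exp(i w·μ - ½ w·Vw)` on `ℝ²ᵐ`. -/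
def gaussChar {m : ℕ} (μ : PhaseVec m) (V : PhaseMat m m) (w : PhaseVec m) : ℂ :=
  Complex.exp (Complex.I * ((w ⬝ᵥ μ : ℝ) : ℂ) - ((w ⬝ᵥ (V *ᵥ w) / 2 : ℝ) : ℂ))

/-- The characteristic function `w ↦ Tr{ρ W(-Ωw)}`. -/
def stateChar {n : ℕ} (hbar : ℝ) (ρ : Op n) (w : PhaseVec n) : ℂ :=
  opTrace (ρ.comp (weylVec hbar (-(Omega hbar n *ᵥ w))))

/-- The complex matrix `V + (i/2) K` with real `V`, `K`. -/
def complexPair {m : ℕ} (V K : PhaseMat m m) : Matrix (Fin m ⊕ Fin m) (Fin m ⊕ Fin m) ℂ :=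
  V.map (fun r : ℝ => (r : ℂ)) + (Complex.I / 2) • K.map (fun r : ℝ => (r : ℂ))

/-- Gaussian states: the characteristic function is `exp(i w·μ - ½ w·Vw)` with
`V + (i/2)Ω ≥ 0`. -/
def IsGaussianState {n : ℕ} (hbar : ℝ) (ρ : Op n) : Prop :=
  IsState ρ ∧ ∃ (μ : PhaseVec n) (V : PhaseMat n n),
    (complexPair V (Omega hbar n)).PosSemidef ∧ ∀ w, stateChar hbar ρ w = gaussChar μ V w

/-! ### Covariant phase-space observables -/

/-- Covariant phase-space observables: POVMs on `ℝⁿ × ℝⁿ` with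
`W(x,p) M(Z) W(x,p)* = M(Z + (x,p))`. -/
def covariantObservables (hbar : ℝ) (n : ℕ) : Set (OpMeasure n (Vec n × Vec n)) :=
  {M | IsPOVM M ∧ ∀ Z, MeasurableSet Z → ∀ x p : Vec n,
    ((weyl hbar x p).comp (M Z)).comp (ContinuousLinearMap.adjoint (weyl hbar x p)) =
      M ((fun z => z + (x, p)) '' Z)}

/-- Gaussian bi-observables: POVMs on `ℝᵐ × ℝᵐ` with characteristic function
`∫ exp(i w·z) M(dz) = W(-Ω Jᵀ w) exp(i w·μ - ½ w·Vw)`, `V` symmetric and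
`V ± (i/2) J Ω Jᵀ ≥ 0`. -/
def IsGaussianObservable {n m : ℕ} (hbar : ℝ) (M : OpMeasure n (Vec m × Vec m)) : Prop :=
  IsPOVM M ∧ ∃ (μ : PhaseVec m) (V : PhaseMat m m) (J : PhaseMat m n),
    V.IsSymm ∧
    (complexPair V (J * Omega hbar n * Jᵀ)).PosSemidef ∧
    (complexPair V (-(J * Omega hbar n * Jᵀ))).PosSemidef ∧
    ∀ w : PhaseVec m,
      HasOpIntegral M (fun z => Complex.exp (Complex.I * ((w ⬝ᵥ stack z : ℝ) : ℂ)))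
        (gaussChar μ V w • weylVec hbar (-(Omega hbar n *ᵥ (Jᵀ *ᵥ w))))

/-- The class of the Gaussian covariant phase-space observables. -/
def gaussianCovariantObservables (hbar : ℝ) (n : ℕ) : Set (OpMeasure n (Vec n × Vec n)) :=
  {M | M ∈ covariantObservables hbar n ∧ IsGaussianObservable hbar M}

/-- The operator density `M^σ(x,p) = (2πħ)⁻ⁿ W(x,p) Π σ Π W(x,p)*`. -/
def obsDensity {n : ℕ} (hbar : ℝ) (σ : Op n) (z : Vec n × Vec n) : Op n :=
  ((((2 * Real.pi * hbar) ^ n)⁻¹ : ℝ) : ℂ) •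
    (((weyl hbar z.1 z.2).comp (((parity n).comp σ).comp (parity n))).comp
      (ContinuousLinearMap.adjoint (weyl hbar z.1 z.2)))

/-- The phase-space observable `M^σ(B) = ∫_B M^σ(x,p) dx dp`. -/
def phaseSpaceObservable {n : ℕ} (hbar : ℝ) (σ : Op n) : OpMeasure n (Vec n × Vec n) :=
  fun B => weakIntegral (volume.restrict B) (obsDensity hbar σ)

/-- The first (position) marginal `M₁(A) = M(A × ℝⁿ)`. -/
def marginalOne {n m : ℕ} (M : OpMeasure n (Vec m × Vec m)) : OpMeasure n (Vec m) :=
  fun A => M (A ×ˢ Set.univ)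

/-- The second (momentum) marginal `M₂(B) = M(ℝⁿ × B)`. -/
def marginalTwo {n m : ℕ} (M : OpMeasure n (Vec m × Vec m)) : OpMeasure n (Vec m) :=
  fun B => M (Set.univ ×ˢ B)

/-! ### Error function and entropic divergence -/

/-- The relative entropy in bits (`InformationTheory.klDiv` is in nats), with values in
`[0, ∞]`. -/
def relEntropy {n : ℕ} (p q : Measure (Vec n)) : ℝ≥0∞ :=
  ENNReal.ofReal (Real.logb 2 (Real.exp 1)) * InformationTheory.klDiv p q

/-- The error function `S(ρ, M) = S(Q_ρ ‖ M_{1,ρ}) + S(P_ρ ‖ M_{2,ρ})`. -/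
def errorFunction {n : ℕ} (hbar : ℝ) (ρ : Op n) (M : OpMeasure n (Vec n × Vec n)) : ℝ≥0∞ :=
  relEntropy (law (positionPVM n) ρ) (law (marginalOne M) ρ) +
    relEntropy (law (momentumPVM hbar n) ρ) (law (marginalTwo M) ρ)

/-- The Gaussian states with `A^ρ ≥ ε₁1` and `B^ρ ≥ ε₂1`. -/
def thresholdStates (hbar : ℝ) (n : ℕ) (ε₁ ε₂ : ℝ) : Set (Op n) :=
  {ρ | IsGaussianState hbar ρ ∧ (posVar ρ - ε₁ • 1).PosSemidef ∧
    (momVar hbar ρ - ε₂ • 1).PosSemidef}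

/-- The Gaussian `ε`-entropic divergence of position and momentum from `M`. -/
def divergence {n : ℕ} (hbar ε₁ ε₂ : ℝ) (M : OpMeasure n (Vec n × Vec n)) : ℝ≥0∞ :=
  ⨆ ρ ∈ thresholdStates hbar n ε₁ ε₂, errorFunction hbar ρ M

/-- The function `s(x) = ln(1+x) - x/(1+x)`. -/
def sFun (x : ℝ) : ℝ := Real.log (1 + x) - x / (1 + x)

/-- The real number `(log₂ e)/2 · [Tr{s(A/ε) + s(B/δ)} + a·(A+ε1)⁻¹a + b·(B+δ1)⁻¹b]`;
`s(A/ε)` and `s(B/δ)` are given by the functional calculus of symmetric matrices. -/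
def gaussianValue {n : ℕ} (A B : Matrix (Fin n) (Fin n) ℝ) (a b : Fin n → ℝ) (ε δ : ℝ) : ℝ :=
  Real.logb 2 (Real.exp 1) / 2 *
    ((cfc sFun (ε⁻¹ • A) + cfc sFun (δ⁻¹ • B)).trace +
      a ⬝ᵥ ((A + ε • 1)⁻¹ *ᵥ a) + b ⬝ᵥ ((B + δ • 1)⁻¹ *ᵥ b))

end EntropicMUR

end

open EntropicMUR

noncomputable section

namespace EntropicMUR

/-! ### The trace -/

/-! The observable $\mathsf M^\sigma$ adds to position and momentum an independent noise,
distributed as in $\sigma$. For vectors $f,\psi$ the Fourier transform over phase space of $|\langle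
W(x,p)\Pi f,\psi\rangle|^2$ factorises into $(2\pi\hbar)^n\langle
f,Wf\rangle\langle\psi,W\psi\rangle$ with $W=W(-\Omega w)$ (`integral_exp_mul_overlapDensity`).
Summing over $f=\sqrt\sigma e_k$ gives $\int e^{iw\cdot z}\mathsf M^\sigma(dz)=\mathrm{Tr}\{\sigma
W\}\,W$ (`hasOpIntegral_phaseSpaceObservable`).

This has two consequences. A nonzero multiple of a Weyl operator determines its argument and its
coefficient, so Gaussianity of $\mathsf M^\sigma$ forces a Gaussian characteristic function on
$\sigma$ (`stateChar_eq_gaussChar`). The marginals in a state $\rho$ are the convolutions of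
$\mathsf Q_\rho$ with $\mathsf Q_\sigma$ and of $\mathsf P_\rho$ with $\mathsf P_\sigma$
(`charFun_marginalOne`, `charFun_marginalTwo`). For Gaussian $\rho$ the position error is therefore
the relative entropy of $N(a^\rho,A^\rho)$ with respect to $N(a^\rho+a^\sigma,A^\rho+A^\sigma)$, and
likewise for momentum.

If $A^\rho\ge\varepsilon_1 1$, both measures arise by convolution with
$N(a^\rho,A^\rho-\varepsilon_1 1)$ from those with variances $\varepsilon_1 1$ and
$A^\sigma+\varepsilon_1 1$. Convolution does not increase relative entropy, so the error is at most
its value at the thresholds (`klDiv_multivariateGaussian_le`). At scalar variance one eigenbasis of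
$A^\sigma$ splits everything into one-dimensional Gaussians, which yields the closed formula
(`klDiv_multivariateGaussian`).

A Gaussian state with variances $\varepsilon 1,\delta 1$ exists when
$\varepsilon\delta\ge\hbar^2/4$: a Gaussian wave function subjected to random Gaussian momentum
kicks (`exists_isGaussianState`). In (i) this attains both bounds at once. In (ii) the momentum
variance $\hbar^2/(4\varepsilon_1)$ exceeds $\varepsilon_2$, so the state still competes in the
supremum and gives a lower bound. -/

lemma orthonormal_countable {E ι : Type*} [NormedAddCommGroup E] [InnerProductSpace ℂ E]
    [TopologicalSpace.SeparableSpace E] {v : ι → E} (hv : Orthonormal ℂ v) : Countable ι := by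
  -- Orthonormal vectors lie at distance $\sqrt2>1$, so balls of radius $1/2$ around them are
  -- disjoint.
  refine Pairwise.countable_of_isOpen_disjoint (s := fun i => Metric.ball (v i) (1 / 2)) ?_
    (fun i => Metric.isOpen_ball) (fun i => ⟨v i, by simp⟩)
  intro i j hij
  refine Metric.ball_disjoint_ball ?_
  have h : ‖v i - v j‖ ^ 2 = 2 := by
    rw [@norm_sub_sq ℂ, hv.1, hv.1, hv.2 hij]; norm_num
  rw [dist_eq_norm]
  nlinarith [norm_nonneg (v i - v j)]

/-- Makes the separability of $L^2$ available to instance search; the resulting countability of the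
basis serves dominated convergence for series indexed by it. -/
instance fact_one_le_two_ennreal : Fact ((2 : ℝ≥0∞) ≠ ∞) := ⟨by simp⟩

instance countable_basisIndex (n : ℕ) : Countable (basisIndex n) :=
  orthonormal_countable (basis n).orthonormal

lemma hasSum_norm_inner_sq {E ι : Type*} [NormedAddCommGroup E] [InnerProductSpace ℂ E]
    (b : HilbertBasis ι ℂ E) (x : E) : HasSum (fun i => ‖inner ℂ (b i) x‖ ^ 2) (‖x‖ ^ 2) := by
  have h := b.hasSum_inner_mul_inner x x
  have h' : (fun i => inner ℂ x (b i) * inner ℂ (b i) x) =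
      fun i => ((‖inner ℂ (b i) x‖ ^ 2 : ℝ) : ℂ) := by
    ext i
    rw [← inner_conj_symm x (b i), Complex.conj_mul', Complex.ofReal_pow]
  rw [h', inner_self_eq_norm_sq_to_K] at h
  have : ((‖x‖ : ℂ) ^ 2) = ((‖x‖ ^ 2 : ℝ) : ℂ) := by push_cast; rfl
  erw [this] at h
  exact Complex.hasSum_ofReal.mp h

/-! ### Square roots of positive operators and cyclicity of the trace. -/

section Sqrt

variable {H : Type*} [NormedAddCommGroup H] [InnerProductSpace ℂ H] [CompleteSpace H]

/-- The square root of a positive operator. -/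
def sqrtOp (T : H →L[ℂ] H) : H →L[ℂ] H := CFC.sqrt T

lemma sqrtOp_sqrtOp_apply {T : H →L[ℂ] H} (hT : T.IsPositive) (x : H) :
    sqrtOp T (sqrtOp T x) = T x :=
  congrArg (fun S : H →L[ℂ] H => S x)
    (CFC.sqrt_mul_sqrt_self T ((ContinuousLinearMap.nonneg_iff_isPositive T).2 hT))

lemma inner_sqrtOp (T : H →L[ℂ] H) (x y : H) :
    inner ℂ (sqrtOp T x) y = inner ℂ x (sqrtOp T y) :=
  ((ContinuousLinearMap.nonneg_iff_isPositive _).1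
    (CFC.sqrt_nonneg T)).inner_left_eq_inner_right x y

lemma inner_apply_eq_norm_sqrtOp {T : H →L[ℂ] H} (hT : T.IsPositive) (x : H) :
    inner ℂ x (T x) = ((‖sqrtOp T x‖ ^ 2 : ℝ) : ℂ) := by
  rw [← sqrtOp_sqrtOp_apply hT, ← inner_sqrtOp, inner_self_eq_norm_sq_to_K]
  simp

/-- Cyclicity $\mathrm{Tr}(TB)=\mathrm{Tr}(\sqrt T B\sqrt T)$. Both sides are iterated sums, in
opposite orders, of one double series, which converges absolutely because $\sqrt T$ and $\sqrt T B$
are Hilbert–Schmidt. -/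
lemma hasSum_trace_mul {ι : Type*} (b : HilbertBasis ι ℂ H) {T : H →L[ℂ] H} (hT : T.IsPositive)
    (h1 : Summable fun k => ‖sqrtOp T (b k)‖ ^ 2) (B : H →L[ℂ] H) :
    HasSum (fun k => inner ℂ (sqrtOp T (b k)) (B (sqrtOp T (b k))))
      (∑' k, inner ℂ (b k) (T (B (b k)))) := by
  set S := sqrtOp T with hS
  have hp : ∀ x y, ‖inner ℂ x (b y)‖ ^ 2 = ‖inner ℂ (b y) x‖ ^ 2 := fun x y => by
    rw [norm_inner_symm]
  let F : ι × ι → ℂ := fun p => inner ℂ (S (b p.1)) (b p.2) * inner ℂ (b p.2) (S (B (b p.1)))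
  have hA : Summable fun p : ι × ι => ‖inner ℂ (S (b p.1)) (b p.2)‖ ^ 2 := by
    refine (summable_prod_of_nonneg (fun p => by positivity)).2 ⟨fun k => ?_, ?_⟩
    · simp only [hp]
      exact (hasSum_norm_inner_sq b (S (b k))).summable
    · convert h1 using 2 with k
      rw [← (hasSum_norm_inner_sq b (S (b k))).tsum_eq]
      simp only [hp]
  have hB : Summable fun p : ι × ι => ‖inner ℂ (b p.2) (S (B (b p.1)))‖ ^ 2 := by
    -- The Hilbert–Schmidt norm of $\sqrt T B$ is that of its adjoint $B^*\sqrt T$, which is at most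
    -- $\|B^*\|$ times that of $\sqrt T$.
    have e : ∀ j k, ‖inner ℂ (b j) (S (B (b k)))‖ ^ 2 =
        ‖inner ℂ (b k) (ContinuousLinearMap.adjoint B (S (b j)))‖ ^ 2 := by
      intro j k
      rw [norm_inner_symm, inner_sqrtOp, ContinuousLinearMap.adjoint_inner_right]
    simp only [e]
    rw [← (Equiv.prodComm _ _).summable_iff]
    refine (summable_prod_of_nonneg (fun p => sq_nonneg _)).2 ⟨fun j => ?_, ?_⟩
    · exact (hasSum_norm_inner_sq b (ContinuousLinearMap.adjoint B (S (b j)))).summable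
    · refine Summable.of_nonneg_of_le (fun j => tsum_nonneg fun k => sq_nonneg _) (fun j => ?_)
        (h1.mul_left (‖ContinuousLinearMap.adjoint B‖ ^ 2))
      have := (hasSum_norm_inner_sq b (ContinuousLinearMap.adjoint B (S (b j)))).tsum_eq
      simp only [Equiv.prodComm_apply, Prod.swap]
      rw [this, ← mul_pow]
      gcongr
      exact ContinuousLinearMap.le_opNorm _ _
  have hF : Summable F := by
    refine Summable.of_norm_bounded (hA.add hB) fun p => ?_
    simp only [F, norm_mul]
    nlinarith [sq_nonneg (‖inner ℂ (S (b p.1)) (b p.2)‖ - ‖inner ℂ (b p.2) (S (B (b p.1)))‖),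
      norm_nonneg (inner ℂ (S (b p.1)) (b p.2)), norm_nonneg (inner ℂ (b p.2) (S (B (b p.1))))]
  have r1 : ∀ k, HasSum (fun j => F (k, j)) (inner ℂ (b k) (T (B (b k)))) := by
    intro k
    have := b.hasSum_inner_mul_inner (S (b k)) (S (B (b k)))
    rwa [inner_sqrtOp, sqrtOp_sqrtOp_apply hT] at this
  have r2 : ∀ j, HasSum (fun k => F (k, j)) (inner ℂ (S (b j)) (B (S (b j)))) := by
    intro j
    have := b.hasSum_inner_mul_inner (ContinuousLinearMap.adjoint B (S (b j))) (S (b j))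
    rw [ContinuousLinearMap.adjoint_inner_left] at this
    have e : (fun k => F (k, j)) = fun i =>
        inner ℂ (ContinuousLinearMap.adjoint B (S (b j))) (b i) * inner ℂ (b i) (S (b j)) := by
      ext k
      rw [ContinuousLinearMap.adjoint_inner_left, ← inner_sqrtOp T (b k), inner_sqrtOp T (b j),
        mul_comm]
    rw [e]
    exact this
  have s1 := hF.hasSum.prod_fiberwise r1
  have hF' : HasSum (F ∘ Prod.swap) (∑' p, F p) := (Equiv.prodComm _ _).hasSum_iff.2 hF.hasSum
  have s2 := hF'.prod_fiberwise r2
  rwa [s1.tsum_eq]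

end Sqrt

/-- The vectors `√ρ eₖ`, which decompose `ρ` as `∑ₖ |√ρ eₖ⟩⟨√ρ eₖ|`. -/
def sqrtVec {n : ℕ} (ρ : Op n) (k : basisIndex n) : Hil n := sqrtOp ρ (basis n k)

lemma hasSum_norm_sqrtVec {n : ℕ} {ρ : Op n} (hρ : IsState ρ) :
    HasSum (fun k => ‖sqrtVec ρ k‖ ^ 2) 1 := by
  rw [← Complex.hasSum_ofReal, Complex.ofReal_one]
  convert hρ.2 using 1
  ext k
  exact (inner_apply_eq_norm_sqrtOp hρ.1 _).symm

lemma hasSum_norm_inner_sqrtVec {n : ℕ} {ρ : Op n} (hρ : IsState ρ) (x : Hil n) :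
    HasSum (fun k => ((‖inner ℂ (sqrtVec ρ k) x‖ ^ 2 : ℝ) : ℂ)) (inner ℂ x (ρ x)) := by
  have h := hasSum_norm_inner_sq (basis n) (sqrtOp ρ x)
  rw [← Complex.hasSum_ofReal] at h
  rw [inner_apply_eq_norm_sqrtOp hρ.1]
  simpa only [sqrtVec, inner_sqrtOp] using h

lemma hasSum_opTrace_comp {n : ℕ} {ρ : Op n} (hρ : IsState ρ) (B : Op n) :
    HasSum (fun k => inner ℂ (sqrtVec ρ k) (B (sqrtVec ρ k))) (opTrace (ρ.comp B)) :=
  hasSum_trace_mul (basis n) hρ.1 (hasSum_norm_sqrtVec hρ).summable B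

/-! ### Laws of operator valued measures -/

lemma measureOf_eq {Z : Type} [MeasurableSpace Z] {m : Set Z → ℝ≥0∞} {μ : Measure Z}
    (h : ∀ B, MeasurableSet B → μ B = m B) : measureOf m = μ := by
  have hex : ∃ μ : Measure Z, ∀ B, MeasurableSet B → μ B = m B := ⟨μ, h⟩
  rw [measureOf, dif_pos hex]
  exact Measure.ext fun B hB => (hex.choose_spec B hB).trans (h B hB).symm

/-- The operators `M B` are positive and, for every vector `ψ`, `B ↦ ⟨ψ, M B ψ⟩` is a finite
measure. -/
structure HasVectorLaws {n : ℕ} {Z : Type} [MeasurableSpace Z] (M : OpMeasure n Z)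
    (m : Hil n → Measure Z) : Prop where
  isPositive : ∀ B, MeasurableSet B → (M B).IsPositive
  apply_eq : ∀ ψ B, MeasurableSet B → m ψ B = ENNReal.ofReal (inner ℂ ψ (M B ψ)).re
  univ_eq : M Set.univ = 1

namespace HasVectorLaws

variable {n : ℕ} {Z : Type} [MeasurableSpace Z] {M : OpMeasure n Z} {m : Hil n → Measure Z}

lemma vectorLaw_eq (h : HasVectorLaws M m) (ψ : Hil n) : vectorLaw M ψ = m ψ :=
  measureOf_eq (h.apply_eq ψ)

lemma measure_univ (h : HasVectorLaws M m) (ψ : Hil n) :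
    m ψ Set.univ = ENNReal.ofReal (‖ψ‖ ^ 2) := by
  rw [h.apply_eq ψ _ MeasurableSet.univ, h.univ_eq, one_apply_eq_self,
    inner_self_eq_norm_sq_to_K]
  norm_cast

/-- Reduces a statement about a state to one about the vectors $\sqrt\rho e_k$. -/
lemma law_eq_sum (h : HasVectorLaws M m) {ρ : Op n} (hρ : IsState ρ) :
    law M ρ = Measure.sum fun k => m (sqrtVec ρ k) := by
  refine measureOf_eq fun B hB => ?_
  have hs := Complex.hasSum_re (hasSum_opTrace_comp hρ (M B))
  rw [Measure.sum_apply _ hB, ← hs.tsum_eq, ENNReal.ofReal_tsum_of_nonneg _ hs.summable]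
  · exact tsum_congr fun k => h.apply_eq _ _ hB
  · intro k
    exact (h.isPositive B hB).re_inner_nonneg_right _

lemma isProbabilityMeasure_law (h : HasVectorLaws M m) {ρ : Op n} (hρ : IsState ρ) :
    IsProbabilityMeasure (law M ρ) := by
  refine ⟨?_⟩
  rw [h.law_eq_sum hρ, Measure.sum_apply _ MeasurableSet.univ]
  simp only [h.measure_univ]
  rw [← ENNReal.ofReal_tsum_of_nonneg (fun k => sq_nonneg _) (hasSum_norm_sqrtVec hρ).summable,
    (hasSum_norm_sqrtVec hρ).tsum_eq, ENNReal.ofReal_one]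

lemma integral_law (h : HasVectorLaws M m) {ρ : Op n} (hρ : IsState ρ) {f : Z → ℂ}
    (hf : Measurable f) {C : ℝ} (hC : ∀ z, ‖f z‖ ≤ C) {T : Op n} (hT : HasOpIntegral M f T) :
    ∫ z, f z ∂(law M ρ) = opTrace (ρ.comp T) := by
  have := h.isProbabilityMeasure_law hρ
  have hi : Integrable f (law M ρ) :=
    Integrable.of_bound hf.aestronglyMeasurable C (Filter.Eventually.of_forall hC)
  rw [h.law_eq_sum hρ] at hi ⊢
  have h1 := hasSum_integral_measure hi
  have h2 := hasSum_opTrace_comp hρ T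
  have e : ∀ k, ∫ z, f z ∂(m (sqrtVec ρ k)) = inner ℂ (sqrtVec ρ k) (T (sqrtVec ρ k)) := by
    intro k
    rw [(hT _).2, h.vectorLaw_eq]
  simp only [e] at h1
  exact h1.unique h2

end HasVectorLaws

/-- Countable additivity makes the set function a genuine measure, so the default value in
`measureOf` never occurs. -/
lemma IsPOVM.hasVectorLaws {n : ℕ} {Z : Type} [MeasurableSpace Z] {M : OpMeasure n Z}
    (hM : IsPOVM M) : HasVectorLaws M (vectorLaw M) := by
  have hempty : ∀ ψ : Hil n, inner ℂ ψ (M ∅ ψ) = 0 := by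
    intro ψ
    -- A constant sequence is summable only if the constant vanishes.
    have := hM.hasSum (fun _ => ∅) (fun _ => MeasurableSet.empty)
      (fun i j _ => by simp [Function.onFun]) ψ ψ
    simpa using ((summable_const_iff _).1 this.summable)
  refine ⟨hM.isPositive, fun ψ B hB => ?_, hM.univ_eq⟩
  let μ : Measure Z := Measure.ofMeasurable
    (fun B _ => ENNReal.ofReal (inner ℂ ψ (M B ψ)).re) (by simp [hempty]) (by
      intro f hf hd
      have hs := Complex.hasSum_re (hM.hasSum f hf hd ψ ψ)
      rw [← hs.tsum_eq, ENNReal.ofReal_tsum_of_nonneg _ hs.summable]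
      intro k
      exact (hM.isPositive _ (hf k)).re_inner_nonneg_right _)
  have hμ : ∀ B, MeasurableSet B → μ B = ENNReal.ofReal (inner ℂ ψ (M B ψ)).re :=
    fun B hB => Measure.ofMeasurable_apply B hB
  rw [vectorLaw, measureOf_eq hμ, hμ B hB]

/-- Used with the coordinate projections, where it makes the marginals of a POVM push-forwards, and
with the scaling from frequency to momentum. -/
lemma HasVectorLaws.preimage {n : ℕ} {Z Y : Type} [MeasurableSpace Z] [MeasurableSpace Y]
    {M : OpMeasure n Z} {m : Hil n → Measure Z} (h : HasVectorLaws M m) {g : Z → Y}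
    (hg : Measurable g) :
    HasVectorLaws (fun B => M (g ⁻¹' B)) (fun ψ => (m ψ).map g) := by
  refine ⟨fun B hB => h.isPositive _ (hg hB), fun ψ B hB => ?_, h.univ_eq⟩
  rw [Measure.map_apply hg hB, h.apply_eq _ _ (hg hB)]

lemma HasOpIntegral.preimage {n : ℕ} {Z Y : Type} [MeasurableSpace Z] [MeasurableSpace Y]
    {M : OpMeasure n Z} {m : Hil n → Measure Z} (h : HasVectorLaws M m) {g : Z → Y}
    (hg : Measurable g) {f : Y → ℂ} (hf : Measurable f) {T : Op n}
    (hT : HasOpIntegral M (fun z => f (g z)) T) :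
    HasOpIntegral (fun B => M (g ⁻¹' B)) f T := by
  intro ψ
  obtain ⟨h1, h2⟩ := hT ψ
  rw [h.vectorLaw_eq] at h1 h2
  rw [(h.preimage hg).vectorLaw_eq]
  refine ⟨(integrable_map_measure hf.aestronglyMeasurable hg.aemeasurable).2 h1, ?_⟩
  rw [integral_map hg.aemeasurable hf.aestronglyMeasurable, h2]

/-! ### Weyl operators -/

lemma mulOp_coe {n : ℕ} (f : Vec n → ℂ) (hf : MemLp f ∞ (volume : Measure (Vec n))) (ψ : Hil n) :
    mulOp f hf ψ =ᵐ[volume] fun y => f y * ψ y := by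
  have h := ContinuousLinearMap.coeFn_holder (r := 2) (ContinuousLinearMap.mul ℂ ℂ) (hf.toLp f) ψ
  filter_upwards [h, hf.coeFn_toLp] with y h1 h2
  change (ContinuousLinearMap.holder 2 (ContinuousLinearMap.mul ℂ ℂ) (hf.toLp f) ψ) y = _
  rw [h1, h2]; rfl

lemma translation_coe {n : ℕ} (x : Vec n) (ψ : Hil n) :
    translation x ψ =ᵐ[volume] fun y => ψ (y - x) :=
  Lp.coeFn_compMeasurePreserving ψ (measurePreserving_sub_right volume x)

lemma parity_coe {n : ℕ} (ψ : Hil n) : parity n ψ =ᵐ[volume] fun y => ψ (-y) :=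
  Lp.coeFn_compMeasurePreserving ψ (Measure.measurePreserving_neg volume)

lemma weyl_coe {n : ℕ} (hbar : ℝ) (x p : Vec n) (ψ : Hil n) :
    weyl hbar x p ψ =ᵐ[volume] fun y => weylPhase hbar x p y * ψ (y - x) := by
  filter_upwards [mulOp_coe _ (memLp_weylPhase hbar x p) (translation x ψ), translation_coe x ψ]
    with y h1 h2
  change (mulOp _ _ (translation x ψ)) y = _
  rw [h1, h2]

lemma norm_weylPhase {n : ℕ} (hbar : ℝ) (x p y : Vec n) : ‖weylPhase hbar x p y‖ = 1 := by
  rw [weylPhase, Complex.norm_exp_ofReal_mul_I]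

lemma ae_comp_sub {n : ℕ} {p : Vec n → Prop} (h : ∀ᵐ y, p y) (x : Vec n) : ∀ᵐ y, p (y - x) :=
  (measurePreserving_sub_right volume x).quasiMeasurePreserving.ae h

lemma norm_weyl {n : ℕ} (hbar : ℝ) (x p : Vec n) (ψ : Hil n) : ‖weyl hbar x p ψ‖ = ‖ψ‖ := by
  have h1 : ‖weyl hbar x p ψ‖ = ‖translation x ψ‖ := by
    rw [Lp.norm_def, Lp.norm_def]
    congr 1
    refine eLpNorm_congr_norm_ae ?_
    filter_upwards [mulOp_coe _ (memLp_weylPhase hbar x p) (translation x ψ)] with y h1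
    change ‖(mulOp _ _ (translation x ψ)) y‖ = _
    rw [h1, norm_mul, norm_weylPhase, one_mul]
  rw [h1]
  exact (Lp.compMeasurePreservingₗᵢ ℂ (fun y : Vec n => y - x)
    (measurePreserving_sub_right volume x)).norm_map ψ

/-- The cocycle `exp((i/2ħ)(p·x' - x·p'))` of the Weyl relations. -/
def weylCocycle {n : ℕ} (hbar : ℝ) (x p x' p' : Vec n) : ℂ :=
  Complex.exp (((hbar⁻¹ * ((inner ℝ p x' - inner ℝ x p') / 2) : ℝ) : ℂ) * Complex.I)

lemma weyl_weyl {n : ℕ} (hbar : ℝ) (x p x' p' : Vec n) (ψ : Hil n) :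
    weyl hbar x p (weyl hbar x' p' ψ) =
      weylCocycle hbar x p x' p' • weyl hbar (x + x') (p + p') ψ := by
  refine Lp.ext ?_
  filter_upwards [weyl_coe hbar x p (weyl hbar x' p' ψ), ae_comp_sub (weyl_coe hbar x' p' ψ) x,
    Lp.coeFn_smul (weylCocycle hbar x p x' p') (weyl hbar (x + x') (p + p') ψ),
    weyl_coe hbar (x + x') (p + p') ψ] with y h1 h2 h3 h4
  rw [h1, h2, h3, Pi.smul_apply, h4, smul_eq_mul, ← mul_assoc, ← mul_assoc, sub_sub]
  congr 1
  rw [weylPhase, weylPhase, weylPhase, weylCocycle, ← Complex.exp_add, ← Complex.exp_add,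
    ← add_mul, ← add_mul, ← Complex.ofReal_add, ← Complex.ofReal_add]
  congr 3
  simp only [inner_add_left, inner_add_right, inner_sub_right]
  rw [real_inner_comm p' x, real_inner_comm x' p]
  ring

lemma weyl_zero {n : ℕ} (hbar : ℝ) (ψ : Hil n) : weyl hbar 0 0 ψ = ψ := by
  refine Lp.ext ?_
  filter_upwards [weyl_coe hbar 0 0 ψ] with y h1
  rw [h1]; simp [weylPhase]

lemma weyl_weyl_neg {n : ℕ} (hbar : ℝ) (x p : Vec n) (ψ : Hil n) :
    weyl hbar x p (weyl hbar (-x) (-p) ψ) = ψ := by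
  rw [weyl_weyl, add_neg_cancel, add_neg_cancel, weyl_zero, weylCocycle, inner_neg_right,
    inner_neg_right, real_inner_comm]
  simp

lemma inner_weyl_weyl {n : ℕ} (hbar : ℝ) (x p : Vec n) (φ ψ : Hil n) :
    inner ℂ (weyl hbar x p φ) (weyl hbar x p ψ) = inner ℂ φ ψ :=
  (⟨(weyl hbar x p).toLinearMap, norm_weyl hbar x p⟩ : Hil n →ₗᵢ[ℂ] Hil n).inner_map_map φ ψ

lemma inner_weyl {n : ℕ} (hbar : ℝ) (x p : Vec n) (φ ψ : Hil n) :
    inner ℂ (weyl hbar x p φ) ψ = inner ℂ φ (weyl hbar (-x) (-p) ψ) := by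
  rw [← inner_weyl_weyl hbar x p φ, weyl_weyl_neg]

lemma parity_parity {n : ℕ} (ψ : Hil n) : parity n (parity n ψ) = ψ := by
  refine Lp.ext ?_
  filter_upwards [parity_coe (parity n ψ),
    (Measure.measurePreserving_neg (volume : Measure (Vec n))).quasiMeasurePreserving.ae
      (parity_coe ψ)] with y h1 h2
  rw [h1, h2, neg_neg]

lemma inner_parity {n : ℕ} (φ ψ : Hil n) :
    inner ℂ (parity n φ) ψ = inner ℂ φ (parity n ψ) := by
  conv_lhs => rw [← parity_parity ψ]
  exact (Lp.compMeasurePreservingₗᵢ ℂ (fun y : Vec n => -y)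
    (Measure.measurePreserving_neg volume)).inner_map_map φ (parity n ψ)

/-- Conjugation by a Weyl operator multiplies $W(x,p)$ by a character in which $(x,p)$ enters
through the symplectic form. This separates Weyl operators and moves wave packets in momentum. -/
lemma inner_weyl_conj {n : ℕ} (hbar : ℝ) (x p u q : Vec n) (φ ψ : Hil n) :
    inner ℂ (weyl hbar u q φ) (weyl hbar x p (weyl hbar u q ψ)) =
      Complex.exp (((hbar⁻¹ * (inner ℝ p u - inner ℝ x q) : ℝ) : ℂ) * Complex.I) *
        inner ℂ φ (weyl hbar x p ψ) := by
  rw [inner_weyl, weyl_weyl, inner_smul_right, weyl_weyl, inner_smul_right, ← mul_assoc]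
  rw [show -u + x + u = x by abel, show -q + p + q = p by abel]
  congr 1
  rw [weylCocycle, weylCocycle, ← Complex.exp_add, ← add_mul, ← Complex.ofReal_add]
  congr 3
  simp only [inner_add_left, inner_neg_left]
  rw [real_inner_comm q u, real_inner_comm q x, real_inner_comm u p]
  ring

/-- If the arguments differed, conjugation by a suitable $W(u,q)$ would multiply the two sides by
different phases. -/
lemma eq_of_smul_weyl_eq {n : ℕ} {hbar : ℝ} (hpos : 0 < hbar) [Nontrivial (Hil n)]
    {x p x' p' : Vec n} {c c' : ℂ} (hc : c ≠ 0)
    (h : c • weyl hbar x p = c' • weyl hbar x' p') : x = x' ∧ p = p' := by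
  have key : ∀ u q : Vec n, inner ℝ (p - p') u - inner ℝ (x - x') q = 0 := by
    intro u₀ q₀
    by_contra hne
    -- Scaled so that the two phases differ by the factor $e^{i\pi}=-1$.
    set t : ℝ := hbar * Real.pi / (inner ℝ (p - p') u₀ - inner ℝ (x - x') q₀) with ht
    have hvec : ∀ φ ψ : Hil n,
        c * inner ℂ φ (weyl hbar x p ψ) = c' * inner ℂ φ (weyl hbar x' p' ψ) := by
      intro φ ψ
      have := congrArg (fun T : Op n => inner ℂ φ (T ψ)) h
      simpa [inner_smul_right] using this
    obtain ⟨ψ, hψ⟩ := exists_ne (0 : Hil n)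
    have h1 := hvec (weyl hbar x p ψ) ψ
    have h2 := hvec (weyl hbar (t • u₀) (t • q₀) (weyl hbar x p ψ)) (weyl hbar (t • u₀) (t • q₀) ψ)
    rw [inner_weyl_conj, inner_weyl_conj, mul_left_comm, mul_left_comm c', ← h1] at h2
    have hn : c * inner ℂ (weyl hbar x p ψ) (weyl hbar x p ψ) ≠ 0 := by
      refine mul_ne_zero hc ?_
      rw [inner_self_ne_zero, ← norm_ne_zero_iff, norm_weyl]
      exact norm_ne_zero_iff.2 hψ
    have h3 := mul_right_cancel₀ hn h2
    have h4 : Complex.exp (((hbar⁻¹ * (inner ℝ (p - p') (t • u₀) - inner ℝ (x - x') (t • q₀)) : ℝ)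
        : ℂ) * Complex.I) = 1 := by
      refine mul_left_cancel₀ (Complex.exp_ne_zero
        (((hbar⁻¹ * (inner ℝ p' (t • u₀) - inner ℝ x' (t • q₀)) : ℝ) : ℂ) * Complex.I)) ?_
      rw [mul_one]
      refine Eq.trans ?_ h3
      rw [← Complex.exp_add, ← add_mul, ← Complex.ofReal_add]
      congr 3
      simp only [inner_sub_left]
      ring
    have h5 : hbar⁻¹ * (inner ℝ (p - p') (t • u₀) - inner ℝ (x - x') (t • q₀)) = Real.pi := by
      rw [inner_smul_right, inner_smul_right, ← mul_sub, ht]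
      field_simp
    rw [h5, Complex.exp_pi_mul_I] at h4
    norm_num at h4
  constructor
  · have := key 0 (x - x')
    rw [inner_zero_right, zero_sub, neg_eq_zero, inner_self_eq_zero] at this
    exact sub_eq_zero.1 this
  · have := key (p - p') 0
    rw [inner_zero_right, sub_zero, inner_self_eq_zero] at this
    exact sub_eq_zero.1 this

section Fourier

open scoped FourierTransform SchwartzMap

/-! ### Fourier transform, position and momentum -/

/-- The $L^2$ transform, defined abstractly, agrees with the integral formula on $L^1\cap L^2$:
tested against a smooth compactly supported function, each moves the transform onto the test
function. -/
lemma fourier_toLp_ae {n : ℕ} {g : Vec n → ℂ} (h1 : Integrable g) (h2 : MemLp g 2) :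
    Lp.fourierTransformₗᵢ (Vec n) ℂ (h2.toLp g) =ᵐ[volume] 𝓕 g := by
  have hcont : Continuous (𝓕 g) :=
    VectorFourier.fourierIntegral_continuous Real.continuous_fourierChar continuous_inner h1
  refine ae_eq_of_integral_contDiff_smul_eq
    ((Lp.memLp _).locallyIntegrable (by norm_num)) hcont.locallyIntegrable fun φ hφ hc => ?_
  have hφ' : ContDiff ℝ (↑(⊤ : ℕ∞)) fun x => (φ x : ℂ) := Complex.ofRealCLM.contDiff.comp hφ
  have hc' : HasCompactSupport fun x => (φ x : ℂ) := hc.comp_left Complex.ofReal_zero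
  set Φ : 𝓢(Vec n, ℂ) := hc'.toSchwartzMap hφ' with hΦ
  have e1 : ∀ f : Vec n → ℂ, ∫ x, φ x • f x = ∫ x, Φ x • f x := fun f => by
    refine integral_congr_ae (Filter.Eventually.of_forall fun x => ?_)
    change φ x • f x = (φ x : ℂ) • f x
    simp
  rw [e1, e1]
  have e2 := Lp.toTemperedDistribution_apply (Lp.fourierTransformₗᵢ (Vec n) ℂ (h2.toLp g)) Φ
  rw [← e2]
  have e3 := Lp.fourier_toTemperedDistribution_eq (h2.toLp g)
  change 𝓕 (Lp.toTemperedDistribution (h2.toLp g)) =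
    Lp.toTemperedDistribution (Lp.fourierTransformₗᵢ (Vec n) ℂ (h2.toLp g)) at e3
  rw [← e3, TemperedDistribution.fourier_apply, Lp.toTemperedDistribution_apply]
  have e4 := VectorFourier.integral_fourierIntegral_smul_eq_flip (e := Real.fourierChar)
    (μ := (volume : Measure (Vec n))) (ν := (volume : Measure (Vec n))) (L := innerₗ (Vec n))
    Real.continuous_fourierChar continuous_inner Φ.integrable h1
  rw [flip_innerₗ] at e4
  refine Eq.trans ?_ e4
  refine integral_congr_ae ?_
  filter_upwards [h2.coeFn_toLp] with x hx
  rw [hx]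
  rfl

lemma fourier_comp_sub {n : ℕ} (g : Vec n → ℂ) (a ξ : Vec n) :
    𝓕 (fun y => g (y - a)) ξ =
      Complex.exp (((-(2 * Real.pi * inner ℝ a ξ) : ℝ) : ℂ) * Complex.I) * 𝓕 g ξ := by
  have := congrFun (VectorFourier.fourierIntegral_comp_add_right Real.fourierChar
    (volume : Measure (Vec n)) (innerₗ (Vec n)) g (-a)) ξ
  change 𝓕 (fun y => g (y + -a)) ξ = Real.fourierChar (inner ℝ (-a) ξ) • 𝓕 g ξ at this
  simp only [← sub_eq_add_neg] at this
  rw [this, Circle.smul_def, Real.fourierChar_apply, inner_neg_left, smul_eq_mul]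
  congr 4
  ring

/-- Translation becomes modulation. With $\hbar$ set to $1$, $W(0,p)$ is multiplication by
$e^{ip\cdot y}$; the factor $2\pi$ is that of the Fourier convention. The identity is checked on
Schwartz functions and extended by density. -/
lemma fourier_weyl {n : ℕ} (hbar : ℝ) (x : Vec n) (ψ : Hil n) :
    Lp.fourierTransformₗᵢ (Vec n) ℂ (weyl hbar x 0 ψ) =
      weyl 1 0 (-(2 * Real.pi) • x) (Lp.fourierTransformₗᵢ (Vec n) ℂ ψ) := by
  have hd := SchwartzMap.denseRange_toLpCLM (E := Vec n) (F := ℂ) (p := 2)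
    (μ := (volume : Measure (Vec n))) ENNReal.ofNat_ne_top
  refine hd.induction_on
    (p := fun ψ : Hil n => Lp.fourierTransformₗᵢ (Vec n) ℂ (weyl hbar x 0 ψ) =
      weyl 1 0 (-(2 * Real.pi) • x) (Lp.fourierTransformₗᵢ (Vec n) ℂ ψ)) ψ ?_ fun f => ?_
  · exact isClosed_eq
      ((Lp.fourierTransformₗᵢ (Vec n) ℂ).continuous.comp (weyl hbar x 0).continuous)
      ((weyl 1 0 _).continuous.comp (Lp.fourierTransformₗᵢ (Vec n) ℂ).continuous)
  · have hg1 : Integrable fun y => f (y - x) := f.integrable.comp_sub_right x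
    have hg2 : MemLp (fun y => f (y - x)) 2 :=
      (f.memLp 2 volume).comp_measurePreserving (measurePreserving_sub_right volume x)
    have e1 : weyl hbar x 0 (f.toLp 2 volume) = hg2.toLp _ := by
      refine Lp.ext ?_
      filter_upwards [weyl_coe hbar x 0 (f.toLp 2 volume), hg2.coeFn_toLp,
        ae_comp_sub (f.coeFn_toLp 2 volume) x] with y h1 h2 h3
      rw [h1, h2, h3]
      simp [weylPhase]
    change Lp.fourierTransformₗᵢ (Vec n) ℂ (weyl hbar x 0 (f.toLp 2 volume)) =
      weyl 1 0 (-(2 * Real.pi) • x) (Lp.fourierTransformₗᵢ (Vec n) ℂ (f.toLp 2 volume))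
    rw [e1]
    refine Lp.ext ?_
    have e2 := fourier_toLp_ae f.integrable (f.memLp 2 volume)
    filter_upwards [fourier_toLp_ae hg1 hg2, e2, weyl_coe 1 0 (-(2 * Real.pi) • x)
      (Lp.fourierTransformₗᵢ (Vec n) ℂ (f.toLp 2 volume))] with ξ h1 h2 h3
    rw [h1, h3, fourier_comp_sub, sub_zero]
    erw [h2]
    congr 1
    rw [weylPhase]
    congr 3
    rw [inner_smul_left, inner_zero_left]
    simp

/-- The position distribution `|ψ(y)|² dy` of a vector. -/
def posLaw {n : ℕ} (ψ : Hil n) : Measure (Vec n) := volume.withDensity fun y => ‖ψ y‖ₑ ^ 2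

lemma integrable_norm_sq_coe {n : ℕ} (ψ : Hil n) : Integrable (fun y => ‖ψ y‖ ^ 2) :=
  (memLp_two_iff_integrable_sq_norm (Lp.memLp ψ).1).1 (Lp.memLp ψ)

lemma enorm_sq_eq_ofReal {E : Type*} [NormedAddCommGroup E] (x : E) :
    ‖x‖ₑ ^ 2 = ENNReal.ofReal (‖x‖ ^ 2) := by
  rw [ENNReal.ofReal_pow (norm_nonneg _), ofReal_norm]

lemma measurable_coe {n : ℕ} (ψ : Hil n) : Measurable ψ := (Lp.stronglyMeasurable ψ).measurable

lemma integral_posLaw {n : ℕ} (ψ : Hil n) (f : Vec n → ℂ) :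
    ∫ y, f y ∂(posLaw ψ) = ∫ y, f y * inner ℂ (ψ y) (ψ y) := by
  rw [posLaw, integral_withDensity_eq_integral_toReal_smul₀
    ((measurable_coe ψ).enorm.pow_const 2).aemeasurable
    (Filter.Eventually.of_forall fun y => by finiteness)]
  refine integral_congr_ae (Filter.Eventually.of_forall fun y => ?_)
  simp only [ENNReal.toReal_pow, toReal_enorm]
  rw [inner_self_eq_norm_sq_to_K, Complex.real_smul, mul_comm]
  simp

lemma posLaw_univ {n : ℕ} (ψ : Hil n) : posLaw ψ Set.univ < ∞ := by
  rw [posLaw, withDensity_apply _ MeasurableSet.univ, Measure.restrict_univ]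
  simp only [enorm_sq_eq_ofReal]
  exact (integrable_norm_sq_coe ψ).lintegral_lt_top

instance isFiniteMeasure_posLaw {n : ℕ} (ψ : Hil n) : IsFiniteMeasure (posLaw ψ) :=
  ⟨posLaw_univ ψ⟩

lemma hasVectorLaws_positionPVM (n : ℕ) : HasVectorLaws (positionPVM n) posLaw := by
  have hinner : ∀ A, MeasurableSet A → ∀ φ ψ : Hil n,
      inner ℂ φ (positionPVM n A ψ) = ∫ y in A, inner ℂ (φ y) (ψ y) := by
    intro A hA φ ψ
    rw [L2.inner_def, ← integral_indicator hA, positionPVM, dif_pos hA]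
    refine integral_congr_ae ?_
    filter_upwards [mulOp_coe _ (memLp_indicator_one hA) ψ] with y hy
    rw [hy]
    by_cases h : y ∈ A <;> simp [h]
  have hself : ∀ A, MeasurableSet A → ∀ ψ : Hil n,
      inner ℂ ψ (positionPVM n A ψ) = ((∫ y in A, ‖ψ y‖ ^ 2 : ℝ) : ℂ) := by
    intro A hA ψ
    rw [hinner A hA, ← integral_complex_ofReal]
    refine integral_congr_ae (Filter.Eventually.of_forall fun y => ?_)
    simp only []
    rw [inner_self_eq_norm_sq_to_K]
    simp
  refine ⟨fun A hA => ?_, fun ψ A hA => ?_, ?_⟩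
  · rw [ContinuousLinearMap.isPositive_iff_complex]
    intro ψ
    have e : inner ℂ (positionPVM n A ψ) ψ = ((∫ y in A, ‖ψ y‖ ^ 2 : ℝ) : ℂ) := by
      rw [← inner_conj_symm, hself A hA, Complex.conj_ofReal]
    rw [e]
    refine ⟨by simp, ?_⟩
    simpa using integral_nonneg fun y => by positivity
  · rw [hself A hA, Complex.ofReal_re, posLaw, withDensity_apply _ hA,
      ofReal_integral_eq_lintegral_ofReal (integrable_norm_sq_coe ψ).integrableOn
        (Filter.Eventually.of_forall fun y => by positivity)]
    simp only [enorm_sq_eq_ofReal]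
  · ext1 ψ
    refine Lp.ext ?_
    rw [positionPVM, dif_pos MeasurableSet.univ]
    filter_upwards [mulOp_coe _ (memLp_indicator_one MeasurableSet.univ) ψ] with y hy
    rw [hy]
    simp

lemma norm_exp_I_mul_ofReal (r : ℝ) : ‖Complex.exp (Complex.I * (r : ℂ))‖ = 1 := by
  rw [mul_comm, Complex.norm_exp_ofReal_mul_I]

lemma integral_exp_posLaw {n : ℕ} {hbar : ℝ} (hpos : 0 < hbar) (k : Vec n) (ψ : Hil n) :
    Integrable (fun y => Complex.exp (Complex.I * ((inner ℝ k y : ℝ) : ℂ))) (posLaw ψ) ∧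
    inner ℂ ψ (weyl hbar 0 (hbar • k) ψ) =
      ∫ y, Complex.exp (Complex.I * ((inner ℝ k y : ℝ) : ℂ)) ∂(posLaw ψ) := by
  constructor
  · refine Integrable.of_bound (C := 1) (Continuous.aestronglyMeasurable (by fun_prop))
      (Filter.Eventually.of_forall fun y => (norm_exp_I_mul_ofReal _).le)
  · rw [integral_posLaw, L2.inner_def]
    refine integral_congr_ae ?_
    filter_upwards [weyl_coe hbar 0 (hbar • k) ψ] with y hy
    rw [hy, sub_zero, weylPhase, ← smul_eq_mul, inner_smul_right]
    congr 2
    rw [inner_smul_left, inner_zero_left, zero_div, sub_zero, mul_comm]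
    congr 2
    simp
    field_simp

lemma hasOpIntegral_positionPVM {n : ℕ} {hbar : ℝ} (hpos : 0 < hbar) (k : Vec n) :
    HasOpIntegral (positionPVM n) (fun y => Complex.exp (Complex.I * ((inner ℝ k y : ℝ) : ℂ)))
      (weyl hbar 0 (hbar • k)) := by
  intro ψ
  rw [(hasVectorLaws_positionPVM n).vectorLaw_eq]
  exact integral_exp_posLaw hpos k ψ

/-- The momentum distribution of a vector. -/
def momLaw {n : ℕ} (hbar : ℝ) (ψ : Hil n) : Measure (Vec n) :=
  (posLaw (Lp.fourierTransformₗᵢ (Vec n) ℂ ψ)).map fun w => (2 * Real.pi * hbar) • w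

lemma inner_momentumPVM {n : ℕ} (hbar : ℝ) (B : Set (Vec n)) (φ ψ : Hil n) :
    inner ℂ φ (momentumPVM hbar n B ψ) = inner ℂ (Lp.fourierTransformₗᵢ (Vec n) ℂ φ)
      (positionPVM n {w | (2 * Real.pi * hbar) • w ∈ B}
        (Lp.fourierTransformₗᵢ (Vec n) ℂ ψ)) := by
  rw [← (Lp.fourierTransformₗᵢ (Vec n) ℂ).inner_map_map]
  congr 1
  exact (Lp.fourierTransformₗᵢ (Vec n) ℂ).apply_symm_apply _

lemma hasVectorLaws_momentumPVM (hbar : ℝ) (n : ℕ) :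
    HasVectorLaws (momentumPVM hbar n) (momLaw hbar) := by
  have hm : Measurable fun w : Vec n => (2 * Real.pi * hbar) • w := measurable_const_smul _
  have h := (hasVectorLaws_positionPVM n).preimage hm
  refine ⟨fun B hB => ?_, fun ψ B hB => ?_, ?_⟩
  · rw [ContinuousLinearMap.isPositive_iff_complex]
    intro ψ
    rw [← inner_conj_symm, inner_momentumPVM]
    have := (ContinuousLinearMap.isPositive_iff_complex _).1 (h.isPositive B hB)
      (Lp.fourierTransformₗᵢ (Vec n) ℂ ψ)
    rw [← inner_conj_symm] at this
    exact this
  · rw [inner_momentumPVM]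
    exact h.apply_eq _ B hB
  · ext1 ψ
    have e := congrArg (fun T : Op n => T (Lp.fourierTransformₗᵢ (Vec n) ℂ ψ)) h.univ_eq
    refine (Lp.fourierTransformₗᵢ (Vec n) ℂ).injective ?_
    refine Eq.trans ((Lp.fourierTransformₗᵢ (Vec n) ℂ).apply_symm_apply _) e

lemma hasOpIntegral_momentumPVM {n : ℕ} {hbar : ℝ} (l : Vec n) :
    HasOpIntegral (momentumPVM hbar n)
      (fun y => Complex.exp (Complex.I * ((inner ℝ l y : ℝ) : ℂ)))
      (weyl hbar (-(hbar • l)) 0) := by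
  intro ψ
  have hm : Measurable fun w : Vec n => (2 * Real.pi * hbar) • w := measurable_const_smul _
  have hf : Continuous fun y : Vec n => Complex.exp (Complex.I * ((inner ℝ l y : ℝ) : ℂ)) := by
    fun_prop
  rw [(hasVectorLaws_momentumPVM hbar n).vectorLaw_eq, momLaw,
    integrable_map_measure hf.aestronglyMeasurable hm.aemeasurable,
    integral_map hm.aemeasurable hf.aestronglyMeasurable]
  have h := integral_exp_posLaw one_pos ((2 * Real.pi * hbar) • l)
    (Lp.fourierTransformₗᵢ (Vec n) ℂ ψ)
  have e : ∀ y : Vec n, inner ℝ ((2 * Real.pi * hbar) • l) y =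
      inner ℝ l ((2 * Real.pi * hbar) • y) := fun y => by
    rw [inner_smul_left, inner_smul_right]; rfl
  simp only [e] at h
  refine ⟨h.1, ?_⟩
  rw [← h.2, ← (Lp.fourierTransformₗᵢ (Vec n) ℂ).inner_map_map, fourier_weyl]
  congr 3
  module

/-! ### The Husimi-type densities `‖⟨W(x,p) Π f, ψ⟩‖²` -/

lemma memLp_comp_sub_left {n : ℕ} (f : Hil n) (x : Vec n) : MemLp (fun y => f (x - y)) 2 :=
  (Lp.memLp f).comp_measurePreserving (Measure.measurePreserving_sub_left volume x)

/-- The product `y ↦ ⟨f(x - y), ψ(y)⟩`. -/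
def crossProd {n : ℕ} (f ψ : Hil n) (x y : Vec n) : ℂ := inner ℂ (f (x - y)) (ψ y)

lemma integrable_crossProd {n : ℕ} (f ψ : Hil n) (x : Vec n) : Integrable (crossProd f ψ x) := by
  have h := L2.integrable_inner (𝕜 := ℂ) ((memLp_comp_sub_left f x).toLp _) ψ
  refine h.congr ?_
  filter_upwards [(memLp_comp_sub_left f x).coeFn_toLp] with y hy
  rw [hy]; rfl

lemma measurable_crossProd {n : ℕ} (f ψ : Hil n) :
    Measurable fun q : Vec n × Vec n => crossProd f ψ q.1 q.2 := by
  unfold crossProd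
  exact ((measurable_coe f).comp (measurable_fst.sub measurable_snd)).inner
    ((measurable_coe ψ).comp measurable_snd)

lemma norm_crossProd_sq {n : ℕ} (f ψ : Hil n) (x y : Vec n) :
    ‖crossProd f ψ x y‖ ^ 2 = ‖ψ y‖ ^ 2 * ‖f (x - y)‖ ^ 2 := by
  rw [crossProd, RCLike.inner_apply, norm_mul, RCLike.norm_conj, mul_pow]

/-- Parity turns $f(y-x)$ into $f(x-y)$, so the overlap is, up to a phase, a Fourier transform in
$y$ of a convolution integrand; Plancherel then handles the $p$-integral. -/
lemma inner_weyl_parity {n : ℕ} {hbar : ℝ} (hpos : 0 < hbar) (f ψ : Hil n) (x p : Vec n) :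
    inner ℂ (weyl hbar x p (parity n f)) ψ =
      Complex.exp (((hbar⁻¹ * (inner ℝ x p / 2) : ℝ) : ℂ) * Complex.I) *
        𝓕 (crossProd f ψ x) ((2 * Real.pi * hbar)⁻¹ • p) := by
  rw [Real.fourier_eq, ← smul_eq_mul, ← integral_smul, L2.inner_def]
  refine integral_congr_ae ?_
  filter_upwards [weyl_coe hbar x p (parity n f), ae_comp_sub (parity_coe f) x] with y h1 h2
  have e : (starRingEnd ℂ) (weylPhase hbar x p y) =
      Complex.exp (((hbar⁻¹ * (inner ℝ x p / 2) : ℝ) : ℂ) * Complex.I) *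
        Complex.exp (((2 * Real.pi * -inner ℝ y ((2 * Real.pi * hbar)⁻¹ • p) : ℝ) : ℂ) *
          Complex.I) := by
    rw [weylPhase, ← Complex.exp_conj, ← Complex.exp_add, ← add_mul, ← Complex.ofReal_add, map_mul,
      Complex.conj_I, Complex.conj_ofReal, mul_neg, ← neg_mul, ← Complex.ofReal_neg,
      inner_smul_right, real_inner_comm y p]
    congr 3
    field_simp
    ring
  rw [h1, h2, crossProd, neg_sub, RCLike.inner_apply, RCLike.inner_apply, map_mul, Circle.smul_def,
    Real.fourierChar_apply, smul_eq_mul, smul_eq_mul, e]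
  ring

/-- The density `‖⟨W(x,p) Π f, ψ⟩‖²` on phase space. -/
def overlapDensity {n : ℕ} (hbar : ℝ) (f ψ : Hil n) (z : Vec n × Vec n) : ℝ :=
  ‖inner ℂ (weyl hbar z.1 z.2 (parity n f)) ψ‖ ^ 2

lemma overlapDensity_eq {n : ℕ} {hbar : ℝ} (hpos : 0 < hbar) (f ψ : Hil n) (z : Vec n × Vec n) :
    overlapDensity hbar f ψ z =
      ‖𝓕 (crossProd f ψ z.1) ((2 * Real.pi * hbar)⁻¹ • z.2)‖ ^ 2 := by
  rw [overlapDensity, inner_weyl_parity hpos, norm_mul, Complex.norm_exp_ofReal_mul_I, one_mul]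

lemma measurable_overlapDensity {n : ℕ} {hbar : ℝ} (hpos : 0 < hbar) (f ψ : Hil n) :
    Measurable (overlapDensity hbar f ψ) := by
  have h : StronglyMeasurable fun q : (Vec n × Vec n) × Vec n =>
      Real.fourierChar (-inner ℝ q.2 ((2 * Real.pi * hbar)⁻¹ • q.1.2)) •
        crossProd f ψ q.1.1 q.2 := by
    refine Measurable.stronglyMeasurable ?_
    simp only [Circle.smul_def, smul_eq_mul]
    refine Measurable.mul ?_ ((measurable_crossProd f ψ).comp
      ((measurable_fst.comp measurable_fst).prodMk measurable_snd))
    simp only [Real.fourierChar_apply]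
    exact Continuous.measurable (by fun_prop)
  have h2 := h.integral_prod_right' (ν := (volume : Measure (Vec n)))
  have e : overlapDensity hbar f ψ = fun z => ‖∫ y, Real.fourierChar
      (-inner ℝ y ((2 * Real.pi * hbar)⁻¹ • z.2)) • crossProd f ψ z.1 y‖ ^ 2 := by
    ext z
    rw [overlapDensity_eq hpos, Real.fourier_eq]
  rw [e]
  exact (h2.norm.measurable).pow_const 2

lemma integrable_norm_fourier_sq {n : ℕ} {g : Vec n → ℂ} (h1 : Integrable g) (h2 : MemLp g 2) :
    Integrable fun ξ => ‖𝓕 g ξ‖ ^ 2 := by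
  refine (integrable_norm_sq_coe (Lp.fourierTransformₗᵢ (Vec n) ℂ (h2.toLp g))).congr ?_
  filter_upwards [fourier_toLp_ae h1 h2] with ξ hξ
  rw [hξ]

/-- Parseval for $g$ and its translate $g(\cdot+a)$: the Fourier transform of $|\mathcal F g|^2$ is
the autocorrelation of $g$. -/
lemma integral_exp_mul_norm_fourier_sq {n : ℕ} {g : Vec n → ℂ} (h1 : Integrable g)
    (h2 : MemLp g 2) (a : Vec n) :
    ∫ ξ, Complex.exp (((2 * Real.pi * inner ℝ a ξ : ℝ) : ℂ) * Complex.I) *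
      ((‖𝓕 g ξ‖ ^ 2 : ℝ) : ℂ) = ∫ y, inner ℂ (g y) (g (y + a)) := by
  set G := h2.toLp g
  have e : inner ℂ (Lp.fourierTransformₗᵢ (Vec n) ℂ G)
      (Lp.fourierTransformₗᵢ (Vec n) ℂ (weyl 1 (-a) 0 G)) = inner ℂ G (weyl 1 (-a) 0 G) :=
    (Lp.fourierTransformₗᵢ (Vec n) ℂ).inner_map_map _ _
  rw [fourier_weyl, L2.inner_def, L2.inner_def] at e
  refine Eq.trans ?_ (e.trans ?_)
  · refine integral_congr_ae ?_
    filter_upwards [fourier_toLp_ae h1 h2, weyl_coe 1 0 (-(2 * Real.pi) • (-a))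
      (Lp.fourierTransformₗᵢ (Vec n) ℂ G)] with ξ e1 e2
    rw [e2, sub_zero, e1, ← smul_eq_mul (weylPhase _ _ _ _), inner_smul_right,
      inner_self_eq_norm_sq_to_K, weylPhase]
    congr 1
    · congr 3
      rw [smul_neg, neg_smul, neg_neg, inner_smul_left, inner_zero_left]
      simp
    · simp
  · refine integral_congr_ae ?_
    filter_upwards [h2.coeFn_toLp, weyl_coe 1 (-a) 0 G, ae_comp_sub h2.coeFn_toLp (-a)]
      with y e1 e2 e3
    rw [e2, e1, e3, sub_neg_eq_add]
    simp [weylPhase]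

lemma integral_comp_inv_smul {E : Type*} [NormedAddCommGroup E] [NormedSpace ℝ E] {n : ℕ} {c : ℝ}
    (hc : 0 < c) (F : Vec n → E) : ∫ p, F (c⁻¹ • p) = (c ^ n : ℝ) • ∫ ξ, F ξ := by
  rw [Measure.integral_comp_smul]
  simp [abs_of_pos hc]

lemma integrable_comp_inv_smul {n : ℕ} {c : ℝ} (hc : 0 < c) {F : Vec n → ℝ} (hF : Integrable F) :
    Integrable fun p => F (c⁻¹ • p) :=
  hF.comp_smul (inv_ne_zero hc.ne')

lemma integrable_prod_norm_sq {n : ℕ} (f ψ : Hil n) :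
    Integrable (fun q : Vec n × Vec n => ‖ψ q.2‖ ^ 2 * ‖f (q.1 - q.2)‖ ^ 2)
      (volume.prod volume) :=
  (integrable_norm_sq_coe ψ).convolution_integrand (ContinuousLinearMap.mul ℝ ℝ)
    (integrable_norm_sq_coe f)

/-- The product is integrable for every $x$, but square integrable only for almost every $x$, by
Fubini for the convolution of $|f|^2$ with $|\psi|^2$. -/
lemma memLp_crossProd_ae {n : ℕ} (f ψ : Hil n) : ∀ᵐ x, MemLp (crossProd f ψ x) 2 := by
  filter_upwards [(integrable_prod_norm_sq f ψ).prod_right_ae] with x hx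
  refine (memLp_two_iff_integrable_sq_norm (integrable_crossProd f ψ x).1).2 ?_
  simpa only [norm_crossProd_sq] using hx

lemma integral_norm_fourier_sq {n : ℕ} {g : Vec n → ℂ} (h1 : Integrable g)
    (h2 : MemLp g 2) : ∫ ξ, ‖𝓕 g ξ‖ ^ 2 = ∫ y, ‖g y‖ ^ 2 := by
  have h := integral_exp_mul_norm_fourier_sq h1 h2 0
  simp only [inner_zero_left, mul_zero, Complex.ofReal_zero, zero_mul, Complex.exp_zero, one_mul,
    add_zero, inner_self_eq_norm_sq_to_K] at h
  rw [integral_complex_ofReal] at h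
  have e : ∀ y, ((‖g y‖ : ℂ)) ^ 2 = ((‖g y‖ ^ 2 : ℝ) : ℂ) := fun y => by push_cast; rfl
  simp only [Complex.coe_algebraMap, e] at h
  rw [integral_complex_ofReal] at h
  exact_mod_cast h

lemma integrable_overlapDensity {n : ℕ} {hbar : ℝ} (hpos : 0 < hbar) (f ψ : Hil n) :
    Integrable (overlapDensity hbar f ψ) (volume.prod volume) := by
  have hc : 0 < 2 * Real.pi * hbar := by positivity
  refine (integrable_prod_iff (measurable_overlapDensity hpos f ψ).aestronglyMeasurable).2 ⟨?_, ?_⟩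
  · filter_upwards [memLp_crossProd_ae f ψ] with x hx
    simp only [overlapDensity_eq hpos]
    exact integrable_comp_inv_smul hc (integrable_norm_fourier_sq (integrable_crossProd f ψ x) hx)
  · refine (((integrable_prod_norm_sq f ψ).integral_prod_left).const_mul
      ((2 * Real.pi * hbar) ^ n)).congr ?_
    filter_upwards [memLp_crossProd_ae f ψ] with x hx
    have e : ∀ p, ‖overlapDensity hbar f ψ (x, p)‖ =
        (fun ξ => ‖𝓕 (crossProd f ψ x) ξ‖ ^ 2) ((2 * Real.pi * hbar)⁻¹ • p) := fun p => by
      rw [overlapDensity_eq hpos, norm_pow, norm_norm]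
    simp only [e]
    rw [integral_comp_inv_smul hc (fun ξ => ‖𝓕 (crossProd f ψ x) ξ‖ ^ 2),
      integral_norm_fourier_sq (integrable_crossProd f ψ x) hx]
    simp [norm_crossProd_sq]

/-- The correlation function `∫ exp(ik·y) ⟨ψ(y), ψ(y + a)⟩ dy`. -/
def correlation {n : ℕ} (k a : Vec n) (ψ : Hil n) : ℂ :=
  ∫ y, Complex.exp (((inner ℝ k y : ℝ) : ℂ) * Complex.I) * inner ℂ (ψ y) (ψ (y + a))

lemma inner_weyl_self {n : ℕ} {hbar : ℝ} (hpos : 0 < hbar) (k a : Vec n) (ψ : Hil n) :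
    inner ℂ ψ (weyl hbar (-a) (hbar • k) ψ) =
      Complex.exp (((inner ℝ k a / 2 : ℝ) : ℂ) * Complex.I) * correlation k a ψ := by
  rw [L2.inner_def, correlation, ← integral_const_mul]
  refine integral_congr_ae ?_
  filter_upwards [weyl_coe hbar (-a) (hbar • k) ψ] with y hy
  rw [hy, ← smul_eq_mul (weylPhase _ _ _ _), inner_smul_right, ← mul_assoc, ← Complex.exp_add,
    ← add_mul, ← Complex.ofReal_add, sub_neg_eq_add, weylPhase]
  congr 4
  rw [inner_smul_left, inner_smul_right, inner_neg_left, real_inner_comm k a]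
  simp
  field_simp
  ring

lemma integrable_inner_comp_add {n : ℕ} (a : Vec n) (ψ : Hil n) :
    Integrable fun y => inner ℂ (ψ y) (ψ (y + a)) := by
  have h := L2.integrable_inner (𝕜 := ℂ) ψ (translation (-a) ψ)
  refine h.congr ?_
  filter_upwards [translation_coe (-a) ψ] with y hy
  rw [hy, sub_neg_eq_add]

lemma integrable_correlation {n : ℕ} (k a : Vec n) (ψ : Hil n) :
    Integrable fun y =>
      Complex.exp (((inner ℝ k y : ℝ) : ℂ) * Complex.I) * inner ℂ (ψ y) (ψ (y + a)) := by
  refine (integrable_inner_comp_add a ψ).bdd_mul (c := 1)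
    (Continuous.aestronglyMeasurable (by fun_prop)) (Filter.Eventually.of_forall fun y => ?_)
  rw [Complex.norm_exp_ofReal_mul_I]

lemma integral_correlation_shift {n : ℕ} (k a : Vec n) (f : Hil n) :
    Integrable (fun u => Complex.exp (((inner ℝ k u : ℝ) : ℂ) * Complex.I) *
      inner ℂ (f (u - a)) (f u)) ∧
    ∫ u, Complex.exp (((inner ℝ k u : ℝ) : ℂ) * Complex.I) * inner ℂ (f (u - a)) (f u) =
      Complex.exp (((inner ℝ k a : ℝ) : ℂ) * Complex.I) * correlation k a f := by
  have e : ∀ u, Complex.exp (((inner ℝ k u : ℝ) : ℂ) * Complex.I) * inner ℂ (f (u - a)) (f u) =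
      (fun v => Complex.exp (((inner ℝ k a : ℝ) : ℂ) * Complex.I) *
        (Complex.exp (((inner ℝ k v : ℝ) : ℂ) * Complex.I) * inner ℂ (f v) (f (v + a))))
        (u - a) := by
    intro u
    simp only [sub_add_cancel]
    rw [← mul_assoc, ← Complex.exp_add, ← add_mul, ← Complex.ofReal_add, inner_sub_right]
    congr 4
    ring
  simp only [e]
  constructor
  · exact ((integrable_correlation k a f).const_mul _).comp_sub_right a
  · rw [integral_sub_right_eq_self (fun v => Complex.exp (((inner ℝ k a : ℝ) : ℂ) * Complex.I) *
        (Complex.exp (((inner ℝ k v : ℝ) : ℂ) * Complex.I) * inner ℂ (f v) (f (v + a)))) a,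
      integral_const_mul]
    rfl

/-- The $p$-integral gives, by Parseval, the autocorrelation of `crossProd f ψ x` with shift $\hbar
l$. As a function of $x$ this is a convolution of a factor made from $f$ with one made from $\psi$,
and the integral of a convolution is the product of the integrals. -/
lemma integral_exp_mul_overlapDensity {n : ℕ} {hbar : ℝ} (hpos : 0 < hbar) (f ψ : Hil n)
    (k l : Vec n) :
    ∫ z, Complex.exp (((inner ℝ k z.1 + inner ℝ l z.2 : ℝ) : ℂ) * Complex.I) *
        ((overlapDensity hbar f ψ z : ℝ) : ℂ) ∂(volume.prod volume) =
      (((2 * Real.pi * hbar) ^ n : ℝ) : ℂ) *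
        (inner ℂ f (weyl hbar (-(hbar • l)) (hbar • k) f) *
          inner ℂ ψ (weyl hbar (-(hbar • l)) (hbar • k) ψ)) := by
  set c := 2 * Real.pi * hbar with hcdef
  set a := hbar • l with ha
  have hc : 0 < c := by positivity
  have hint : Integrable (fun z : Vec n × Vec n =>
      Complex.exp (((inner ℝ k z.1 + inner ℝ l z.2 : ℝ) : ℂ) * Complex.I) *
        ((overlapDensity hbar f ψ z : ℝ) : ℂ)) (volume.prod volume) := by
    refine (integrable_overlapDensity hpos f ψ).ofReal.bdd_mul (c := 1)
      (Continuous.aestronglyMeasurable (by fun_prop)) (Filter.Eventually.of_forall fun y => ?_)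
    rw [Complex.norm_exp_ofReal_mul_I]
  rw [integral_prod _ hint]
  set h1 : Vec n → ℂ := fun u =>
    Complex.exp (((inner ℝ k u : ℝ) : ℂ) * Complex.I) * inner ℂ (f (u - a)) (f u) with hh1
  set h2 : Vec n → ℂ := fun y =>
    Complex.exp (((inner ℝ k y : ℝ) : ℂ) * Complex.I) * inner ℂ (ψ y) (ψ (y + a)) with hh2
  have hx : ∀ᵐ x, ∫ p, Complex.exp (((inner ℝ k x + inner ℝ l p : ℝ) : ℂ) * Complex.I) *
      ((overlapDensity hbar f ψ (x, p) : ℝ) : ℂ) =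
      ((c ^ n : ℝ) : ℂ) * (convolution h2 h1 (ContinuousLinearMap.mul ℂ ℂ) volume x) := by
    filter_upwards [memLp_crossProd_ae f ψ] with x hx
    have e : ∀ p, Complex.exp (((inner ℝ k x + inner ℝ l p : ℝ) : ℂ) * Complex.I) *
        ((overlapDensity hbar f ψ (x, p) : ℝ) : ℂ) =
        Complex.exp (((inner ℝ k x : ℝ) : ℂ) * Complex.I) *
        (fun ξ => Complex.exp (((2 * Real.pi * inner ℝ a ξ : ℝ) : ℂ) * Complex.I) *
          ((‖𝓕 (crossProd f ψ x) ξ‖ ^ 2 : ℝ) : ℂ)) (c⁻¹ • p) := by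
      intro p
      simp only []
      rw [overlapDensity_eq hpos, ← mul_assoc, ← Complex.exp_add, ← add_mul, ← Complex.ofReal_add]
      congr 5
      rw [ha, inner_smul_left, inner_smul_right, hcdef]
      simp
      field_simp
    rw [integral_congr_ae (Filter.Eventually.of_forall e), integral_const_mul,
      integral_comp_inv_smul hc (fun ξ => Complex.exp (((2 * Real.pi * inner ℝ a ξ : ℝ) : ℂ) *
        Complex.I) * ((‖𝓕 (crossProd f ψ x) ξ‖ ^ 2 : ℝ) : ℂ)),
      integral_exp_mul_norm_fourier_sq (integrable_crossProd f ψ x) hx, Complex.real_smul,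
      mul_left_comm, ← integral_const_mul, convolution]
    congr 1
    refine integral_congr_ae (Filter.Eventually.of_forall fun y => ?_)
    simp only [hh1, hh2, crossProd, ContinuousLinearMap.mul_apply', RCLike.inner_apply, map_mul,
      Complex.conj_conj, inner_sub_right, ← sub_sub]
    rw [Complex.ofReal_sub, sub_mul, Complex.exp_sub]
    field_simp
  rw [integral_congr_ae hx, integral_const_mul, integral_convolution _
    (integrable_correlation k a ψ) (integral_correlation_shift k a f).1,
    (integral_correlation_shift k a f).2, inner_weyl_self hpos, inner_weyl_self hpos]
  congr 1
  -- The two Weyl expectations each carry the phase $e^{ik\cdot a/2}$; together they make the single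
  -- $e^{ik\cdot a}$ left by the shift in the $f$-factor.
  rw [mul_mul_mul_comm, ← Complex.exp_add, ← add_mul, ← Complex.ofReal_add, add_halves,
    ContinuousLinearMap.mul_apply']
  change correlation k a ψ * _ = _
  ring

end Fourier

/-! ### Characteristic function of the phase-space observable -/

/-- The upper block of a phase-space vector. -/
def upper {m : ℕ} (w : PhaseVec m) : Vec m := WithLp.toLp 2 fun i => w (Sum.inl i)

/-- The lower block of a phase-space vector. -/
def lower {m : ℕ} (w : PhaseVec m) : Vec m := WithLp.toLp 2 fun i => w (Sum.inr i)

lemma dotProduct_stack {m : ℕ} (w : PhaseVec m) (z : Vec m × Vec m) :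
    w ⬝ᵥ stack z = inner ℝ (upper w) z.1 + inner ℝ (lower w) z.2 := by
  simp [dotProduct, stack, upper, lower, PiLp.inner_apply, mul_comm]

lemma upper_neg_Omega {n : ℕ} (hbar : ℝ) (w : PhaseVec n) :
    upper (-(Omega hbar n *ᵥ w)) = -(hbar • lower w) := by
  ext i
  simp [upper, lower, Omega, Matrix.mulVec, dotProduct, Fintype.sum_sum_type, Matrix.one_apply]

lemma lower_neg_Omega {n : ℕ} (hbar : ℝ) (w : PhaseVec n) :
    lower (-(Omega hbar n *ᵥ w)) = hbar • upper w := by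
  ext i
  simp [upper, lower, Omega, Matrix.mulVec, dotProduct, Fintype.sum_sum_type, Matrix.one_apply]

lemma weylVec_neg_Omega {n : ℕ} (hbar : ℝ) (w : PhaseVec n) :
    weylVec hbar (-(Omega hbar n *ᵥ w)) = weyl hbar (-(hbar • lower w)) (hbar • upper w) := by
  rw [← upper_neg_Omega, ← lower_neg_Omega]; rfl

/-- The Husimi-type function `z ↦ ⟨ψ, M^σ(z) ψ⟩`. -/
def husimi {n : ℕ} (hbar : ℝ) (σ : Op n) (ψ : Hil n) (z : Vec n × Vec n) : ℝ :=
  (inner ℂ ψ (obsDensity hbar σ z ψ)).re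

lemma hasSum_husimi {n : ℕ} {hbar : ℝ} {σ : Op n} (hσ : IsState σ) (ψ : Hil n)
    (z : Vec n × Vec n) :
    inner ℂ ψ (obsDensity hbar σ z ψ) = ((husimi hbar σ ψ z : ℝ) : ℂ) ∧
    HasSum (fun k => ((2 * Real.pi * hbar) ^ n)⁻¹ * overlapDensity hbar (sqrtVec σ k) ψ z)
      (husimi hbar σ ψ z) := by
  set W := weyl hbar z.1 z.2
  set χ := parity n (ContinuousLinearMap.adjoint W ψ)
  have e1 : inner ℂ ψ (obsDensity hbar σ z ψ) =
      ((((2 * Real.pi * hbar) ^ n)⁻¹ : ℝ) : ℂ) * inner ℂ χ (σ χ) := by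
    have : obsDensity hbar σ z ψ =
      ((((2 * Real.pi * hbar) ^ n)⁻¹ : ℝ) : ℂ) • W (parity n (σ χ)) := rfl
    rw [this, inner_smul_right, inner_parity, ContinuousLinearMap.adjoint_inner_left]
  have e2 : ∀ k, ‖inner ℂ (sqrtVec σ k) χ‖ ^ 2 = overlapDensity hbar (sqrtVec σ k) ψ z := by
    intro k
    rw [← inner_parity, ContinuousLinearMap.adjoint_inner_right]; rfl
  have h := hasSum_norm_inner_sqrtVec hσ χ
  simp only [e2] at h
  have h' : inner ℂ ψ (obsDensity hbar σ z ψ) = ((husimi hbar σ ψ z : ℝ) : ℂ) := by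
    rw [husimi, e1, ← h.tsum_eq, ← Complex.ofReal_tsum, ← Complex.ofReal_mul, Complex.ofReal_re]
  refine ⟨h', ?_⟩
  rw [← Complex.hasSum_ofReal, ← h', e1]
  simp only [Complex.ofReal_mul]
  exact h.mul_left _

lemma husimi_nonneg {n : ℕ} {hbar : ℝ} (hpos : 0 < hbar) {σ : Op n} (hσ : IsState σ) (ψ : Hil n)
    (z : Vec n × Vec n) : 0 ≤ husimi hbar σ ψ z := by
  refine (hasSum_husimi hσ ψ z).2.nonneg fun k => ?_
  unfold overlapDensity
  positivity

lemma nontrivial_of_isState {n : ℕ} {ρ : Op n} (hρ : IsState ρ) : Nontrivial (Hil n) := by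
  by_contra h
  rw [not_nontrivial_iff_subsingleton] at h
  have h2 := hρ.2
  have e : ∀ i, inner ℂ (basis n i) (ρ (basis n i)) = 0 := fun i => by
    rw [Subsingleton.elim (ρ (basis n i)) 0, inner_zero_right]
  simp only [e] at h2
  exact zero_ne_one (hasSum_zero.unique h2)

/-- `T` is the weak integral of `F` with respect to `μ`. -/
def IsWeakIntegral {n : ℕ} {Z : Type} [MeasurableSpace Z] (μ : Measure Z) (F : Z → Op n)
    (T : Op n) : Prop :=
  ∀ φ ψ : Hil n, Integrable (fun z => inner ℂ φ (F z ψ)) μ ∧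
    inner ℂ φ (T ψ) = ∫ z, inner ℂ φ (F z ψ) ∂μ

lemma isWeakIntegral_weakIntegral {n : ℕ} {Z : Type} [MeasurableSpace Z] {μ : Measure Z}
    {F : Z → Op n} (h : ∃ T, IsWeakIntegral μ F T) : IsWeakIntegral μ F (weakIntegral μ F) := by
  have h' : ∃ T : Op n, ∀ φ ψ : Hil n, Integrable (fun z => inner ℂ φ (F z ψ)) μ ∧
    inner ℂ φ (T ψ) = ∫ z, inner ℂ φ (F z ψ) ∂μ := h
  rw [weakIntegral, dif_pos h']
  exact h'.choose_spec

lemma exists_isWeakIntegral_of_ne_zero {n : ℕ} {Z : Type} [MeasurableSpace Z] {μ : Measure Z}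
    {F : Z → Op n} (h : weakIntegral μ F ≠ 0) : ∃ T, IsWeakIntegral μ F T := by
  by_contra hne
  refine h ?_
  rw [weakIntegral, dif_neg]
  exact hne

/-- Excludes the default value of `weakIntegral` using the POVM property alone. The value on the
whole space is $1\ne0$, so that integral exists. The integrals over $B$ and its complement cannot
both fail, since both values would then be $0$ and not add up to $1$; if only the one over $B$
failed, subtraction from $1$ would produce it. -/
lemma isWeakIntegral_phaseSpaceObservable {n : ℕ} {hbar : ℝ} {σ : Op n} (hσ : IsState σ)
    (hM : IsPOVM (phaseSpaceObservable hbar σ)) {B : Set (Vec n × Vec n)} (hB : MeasurableSet B) :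
    IsWeakIntegral (volume.restrict B) (obsDensity hbar σ) (phaseSpaceObservable hbar σ B) := by
  have hnt := nontrivial_of_isState hσ
  obtain ⟨ψ₀, hψ₀⟩ := exists_ne (0 : Hil n)
  have huniv : IsWeakIntegral volume (obsDensity hbar σ) 1 := by
    have h1 : weakIntegral (volume.restrict Set.univ) (obsDensity hbar σ) = 1 := hM.univ_eq
    rw [← Measure.restrict_univ (μ := (volume : Measure (Vec n × Vec n))), ← h1]
    refine isWeakIntegral_weakIntegral (exists_isWeakIntegral_of_ne_zero ?_)
    rw [h1]
    intro h0
    exact hψ₀ (congrArg (fun T : Op n => T ψ₀) h0)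
  by_cases hPB : ∃ T, IsWeakIntegral (volume.restrict B) (obsDensity hbar σ) T
  · exact isWeakIntegral_weakIntegral hPB
  · have hPc : ∃ T, IsWeakIntegral (volume.restrict Bᶜ) (obsDensity hbar σ) T := by
      by_contra hPc
      have z1 : phaseSpaceObservable hbar σ B = 0 := by
        by_contra h; exact hPB (exists_isWeakIntegral_of_ne_zero h)
      have z2 : phaseSpaceObservable hbar σ Bᶜ = 0 := by
        by_contra h; exact hPc (exists_isWeakIntegral_of_ne_zero h)
      have h := hM.hasVectorLaws
      have h3 := measure_add_measure_compl (μ := vectorLaw (phaseSpaceObservable hbar σ) ψ₀) hB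
      rw [h.apply_eq _ _ hB, h.apply_eq _ _ hB.compl, h.measure_univ, z1, z2] at h3
      simp at h3
      exact hψ₀ (by simpa using h3.symm)
    exfalso
    obtain ⟨T, hT⟩ := hPc
    refine hPB ⟨1 - T, fun φ ψ => ⟨(huniv φ ψ).1.integrableOn, ?_⟩⟩
    have h4 := integral_add_compl hB (huniv φ ψ).1
    rw [← (huniv φ ψ).2, ← (hT φ ψ).2] at h4
    have e : inner ℂ φ ((1 - T) ψ) = inner ℂ φ ((1 : Op n) ψ) - inner ℂ φ (T ψ) := by
      rw [← inner_sub_right]; rfl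
    rw [e, ← h4, add_sub_cancel_right]

lemma vectorLaw_phaseSpaceObservable {n : ℕ} {hbar : ℝ} (hpos : 0 < hbar) {σ : Op n}
    (hσ : IsState σ) (hM : IsPOVM (phaseSpaceObservable hbar σ)) (ψ : Hil n) :
    Integrable (husimi hbar σ ψ) ∧
    vectorLaw (phaseSpaceObservable hbar σ) ψ =
      volume.withDensity fun z => ENNReal.ofReal (husimi hbar σ ψ z) := by
  have hF : (fun z => inner ℂ ψ (obsDensity hbar σ z ψ)) = fun z => ((husimi hbar σ ψ z : ℝ) : ℂ) :=
    funext fun z => (hasSum_husimi hσ ψ z).1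
  have hint : Integrable (husimi hbar σ ψ) := by
    have := (isWeakIntegral_phaseSpaceObservable hσ hM MeasurableSet.univ ψ ψ).1
    rw [Measure.restrict_univ] at this
    exact this.re
  refine ⟨hint, Measure.ext fun B hB => ?_⟩
  rw [hM.hasVectorLaws.apply_eq _ _ hB, withDensity_apply _ hB,
    (isWeakIntegral_phaseSpaceObservable hσ hM hB ψ ψ).2, hF, integral_complex_ofReal,
    Complex.ofReal_re, ofReal_integral_eq_lintegral_ofReal hint.integrableOn
      (Filter.Eventually.of_forall fun z => husimi_nonneg hpos hσ ψ z)]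

/-- The density is the sum over $k$ of the overlap densities of $\sqrt\sigma e_k$ with $\psi$. Each
term contributes a product of Weyl expectations, and summation over $k$ turns the first factors into
$\mathrm{Tr}\{\sigma W\}$. -/
lemma hasOpIntegral_phaseSpaceObservable {n : ℕ} {hbar : ℝ} (hpos : 0 < hbar) {σ : Op n}
    (hσ : IsState σ) (hM : IsPOVM (phaseSpaceObservable hbar σ)) (w : PhaseVec n) :
    HasOpIntegral (phaseSpaceObservable hbar σ)
      (fun z => Complex.exp (Complex.I * ((w ⬝ᵥ stack z : ℝ) : ℂ)))
      (stateChar hbar σ w • weylVec hbar (-(Omega hbar n *ᵥ w))) := by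
  intro ψ
  obtain ⟨hint, hlaw⟩ := vectorLaw_phaseSpaceObservable hpos hσ hM ψ
  have hfin : IsFiniteMeasure (vectorLaw (phaseSpaceObservable hbar σ) ψ) := by
    refine ⟨?_⟩
    rw [hM.hasVectorLaws.measure_univ]
    exact ENNReal.ofReal_lt_top
  have hcont : Continuous fun z : Vec n × Vec n =>
      Complex.exp (Complex.I * ((w ⬝ᵥ stack z : ℝ) : ℂ)) := by
    simp only [dotProduct_stack]; fun_prop
  have hnorm : ∀ z : Vec n × Vec n,
      ‖Complex.exp (Complex.I * ((w ⬝ᵥ stack z : ℝ) : ℂ))‖ = 1 := fun z => norm_exp_I_mul_ofReal _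
  refine ⟨Integrable.of_bound (C := 1) hcont.aestronglyMeasurable
    (Filter.Eventually.of_forall fun z => (hnorm z).le), ?_⟩
  have e1 : ∫ z, Complex.exp (Complex.I * ((w ⬝ᵥ stack z : ℝ) : ℂ))
      ∂(vectorLaw (phaseSpaceObservable hbar σ) ψ) =
      ∫ z, Complex.exp (Complex.I * ((w ⬝ᵥ stack z : ℝ) : ℂ)) * ((husimi hbar σ ψ z : ℝ) : ℂ) := by
    rw [hlaw, integral_withDensity_eq_integral_toReal_smul₀ hint.1.aemeasurable.ennreal_ofReal
      (Filter.Eventually.of_forall fun y => ENNReal.ofReal_lt_top)]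
    refine integral_congr_ae (Filter.Eventually.of_forall fun z => ?_)
    simp only []
    rw [ENNReal.toReal_ofReal (husimi_nonneg hpos hσ ψ z), Complex.real_smul, mul_comm]
  rw [e1]
  set c : ℝ := ((2 * Real.pi * hbar) ^ n)⁻¹ with hc
  have hc0 : 0 < c := by positivity
  -- The terms are nonnegative up to a common phase, so their own sum, the integrable density,
  -- dominates the series.
  have hs := hasSum_integral_of_dominated_convergence
    (μ := (volume : Measure (Vec n × Vec n)))
    (F := fun (k : basisIndex n) z => Complex.exp (Complex.I * ((w ⬝ᵥ stack z : ℝ) : ℂ)) *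
      ((c * overlapDensity hbar (sqrtVec σ k) ψ z : ℝ) : ℂ))
    (f := fun z => Complex.exp (Complex.I * ((w ⬝ᵥ stack z : ℝ) : ℂ)) *
      ((husimi hbar σ ψ z : ℝ) : ℂ))
    (fun k z => c * overlapDensity hbar (sqrtVec σ k) ψ z)
    (fun k => hcont.aestronglyMeasurable.mul
      (Complex.continuous_ofReal.comp_aestronglyMeasurable
        ((measurable_overlapDensity hpos (sqrtVec σ k) ψ).const_mul c).aestronglyMeasurable))
    (fun k => Filter.Eventually.of_forall fun z => by
      rw [norm_mul, hnorm, one_mul, Complex.norm_real, Real.norm_of_nonneg]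
      unfold overlapDensity
      positivity)
    (Filter.Eventually.of_forall fun z => (hasSum_husimi hσ ψ z).2.summable)
    (hint.congr (Filter.Eventually.of_forall fun z => (hasSum_husimi hσ ψ z).2.tsum_eq.symm))
    (Filter.Eventually.of_forall fun z =>
      (Complex.hasSum_ofReal.2 (hasSum_husimi hσ ψ z).2).mul_left _)
  have hs2 := (hasSum_opTrace_comp hσ (weylVec hbar (-(Omega hbar n *ᵥ w)))).mul_right
    (inner ℂ ψ (weylVec hbar (-(Omega hbar n *ᵥ w)) ψ))
  have e2 : ∀ k, ∫ z, Complex.exp (Complex.I * ((w ⬝ᵥ stack z : ℝ) : ℂ)) *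
      ((c * overlapDensity hbar (sqrtVec σ k) ψ z : ℝ) : ℂ) =
      inner ℂ (sqrtVec σ k) (weylVec hbar (-(Omega hbar n *ᵥ w)) (sqrtVec σ k)) *
      inner ℂ ψ (weylVec hbar (-(Omega hbar n *ᵥ w)) ψ) := by
    intro k
    have h := integral_exp_mul_overlapDensity hpos (sqrtVec σ k) ψ (upper w) (lower w)
    rw [← weylVec_neg_Omega] at h
    have e3 : ∀ z : Vec n × Vec n, Complex.exp (Complex.I * ((w ⬝ᵥ stack z : ℝ) : ℂ)) *
      ((c * overlapDensity hbar (sqrtVec σ k) ψ z : ℝ) : ℂ) = (c : ℂ) *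
        (Complex.exp (((inner ℝ (upper w) z.1 + inner ℝ (lower w) z.2 : ℝ) : ℂ) * Complex.I) *
        ((overlapDensity hbar (sqrtVec σ k) ψ z : ℝ) : ℂ)) := by
      intro z
      rw [dotProduct_stack, Complex.ofReal_mul, mul_comm Complex.I]
      ring
    simp only [e3]
    rw [integral_const_mul, Measure.volume_eq_prod, h, ← mul_assoc, ← Complex.ofReal_mul, hc,
      inv_mul_cancel₀ (by positivity), Complex.ofReal_one, one_mul]
  simp only [e2] at hs
  rw [hs.unique hs2]
  exact inner_smul_right _ _ _

/-! ### Recovering the characteristic function of σ from the observable. -/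

lemma op_ext_of_inner_self {n : ℕ} {S T : Op n} (h : ∀ ψ : Hil n, inner ℂ ψ (S ψ) = inner ℂ ψ (T ψ)) :
    S = T := by
  have : S.toLinearMap = T.toLinearMap := by
    rw [← ext_inner_map]
    intro ψ
    rw [← inner_conj_symm, ← inner_conj_symm (T.toLinearMap ψ)]
    exact congrArg _ (h ψ)
  exact ContinuousLinearMap.coe_injective this

lemma HasOpIntegral.unique {n : ℕ} {Z : Type} [MeasurableSpace Z] {M : OpMeasure n Z} {f : Z → ℂ}
    {S T : Op n} (hS : HasOpIntegral M f S) (hT : HasOpIntegral M f T) : S = T :=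
  op_ext_of_inner_self fun ψ => (hS ψ).2.trans (hT ψ).2.symm

lemma eq_of_smul_weylVec_eq {n : ℕ} {hbar : ℝ} (hpos : 0 < hbar) [Nontrivial (Hil n)]
    {u v : PhaseVec n} {c c' : ℂ} (hc : c ≠ 0) (h : c • weylVec hbar u = c' • weylVec hbar v) :
    c = c' := by
  obtain ⟨hx, hp⟩ := eq_of_smul_weyl_eq hpos hc h
  obtain ⟨ψ, hψ⟩ := exists_ne (0 : Hil n)
  have e : weylVec hbar u = weylVec hbar v := by rw [weylVec, weylVec, hx, hp]
  rw [e] at h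
  have h2 : c • weylVec hbar v ψ = c' • weylVec hbar v ψ := congrArg (fun T : Op n => T ψ) h
  refine smul_left_injective ℂ ?_ h2
  rw [← norm_ne_zero_iff, weylVec, norm_weyl]
  exact norm_ne_zero_iff.2 hψ

/-- Two evaluations of one operator integral are compared. The matrix $J$ need not be known
beforehand: equality of the multiples already matches the Weyl arguments. -/
lemma stateChar_eq_gaussChar {n : ℕ} {hbar : ℝ} (hpos : 0 < hbar) {σ : Op n} (hσ : IsState σ)
    (hM : IsPOVM (phaseSpaceObservable hbar σ)) {μ : PhaseVec n} {V J : PhaseMat n n}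
    {w : PhaseVec n}
    (h : HasOpIntegral (phaseSpaceObservable hbar σ)
      (fun z => Complex.exp (Complex.I * ((w ⬝ᵥ stack z : ℝ) : ℂ)))
        (gaussChar μ V w • weylVec hbar (-(Omega hbar n *ᵥ (Jᵀ *ᵥ w))))) :
    stateChar hbar σ w = gaussChar μ V w := by
  have := nontrivial_of_isState hσ
  exact (eq_of_smul_weylVec_eq hpos (Complex.exp_ne_zero _)
    (h.unique (hasOpIntegral_phaseSpaceObservable hpos hσ hM w))).symm

/-! ### Characteristic functions of the outcome distributions -/

/-- The phase-space vector with upper block `k` and lower block `0`. -/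
def inUpper {m : ℕ} (k : Vec m) : PhaseVec m := Sum.elim k 0

/-- The phase-space vector with upper block `0` and lower block `l`. -/
def inLower {m : ℕ} (l : Vec m) : PhaseVec m := Sum.elim 0 l

lemma exp_inner_eq {m : ℕ} (k y : Vec m) :
    Complex.exp (((inner ℝ y k : ℝ) : ℂ) * Complex.I) =
      Complex.exp (Complex.I * ((inner ℝ k y : ℝ) : ℂ)) := by
  rw [real_inner_comm, mul_comm]

lemma weylVec_inUpper {n : ℕ} (hbar : ℝ) (k : Vec n) :
    weylVec hbar (-(Omega hbar n *ᵥ inUpper k)) = weyl hbar 0 (hbar • k) := by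
  rw [weylVec_neg_Omega]
  have e1 : lower (inUpper k) = 0 := rfl
  have e2 : upper (inUpper k) = k := rfl
  rw [e1, e2, smul_zero, neg_zero]

lemma weylVec_inLower {n : ℕ} (hbar : ℝ) (l : Vec n) :
    weylVec hbar (-(Omega hbar n *ᵥ inLower l)) = weyl hbar (-(hbar • l)) 0 := by
  rw [weylVec_neg_Omega]
  have e1 : lower (inLower l) = l := rfl
  have e2 : upper (inLower l) = 0 := rfl
  rw [e1, e2, smul_zero]

lemma charFun_law {n m : ℕ} {M : OpMeasure n (Vec m)} {q : Hil n → Measure (Vec m)}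
    (h : HasVectorLaws M q) {ρ : Op n} (hρ : IsState ρ) (k : Vec m) {T : Op n}
    (hT : HasOpIntegral M (fun y => Complex.exp (Complex.I * ((inner ℝ k y : ℝ) : ℂ))) T) :
    charFun (law M ρ) k = opTrace (ρ.comp T) := by
  rw [charFun_apply]
  simp only [exp_inner_eq]
  exact h.integral_law hρ (Continuous.measurable (by fun_prop))
    (fun z => (norm_exp_I_mul_ofReal _).le) hT

lemma charFun_position {n : ℕ} {hbar : ℝ} (hpos : 0 < hbar) {ρ : Op n} (hρ : IsState ρ)
    (k : Vec n) : charFun (law (positionPVM n) ρ) k = stateChar hbar ρ (inUpper k) := by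
  rw [stateChar, weylVec_inUpper]
  exact charFun_law (hasVectorLaws_positionPVM n) hρ k (hasOpIntegral_positionPVM hpos k)

lemma charFun_momentum {n : ℕ} {hbar : ℝ} {ρ : Op n} (hρ : IsState ρ)
    (l : Vec n) : charFun (law (momentumPVM hbar n) ρ) l = stateChar hbar ρ (inLower l) := by
  rw [stateChar, weylVec_inLower]
  exact charFun_law (hasVectorLaws_momentumPVM hbar n) hρ l (hasOpIntegral_momentumPVM l)

lemma opTrace_comp_smul {n : ℕ} (ρ T : Op n) (c : ℂ) :
    opTrace (ρ.comp (c • T)) = c * opTrace (ρ.comp T) := by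
  rw [opTrace, opTrace, ← tsum_mul_left]
  refine tsum_congr fun i => ?_
  rw [← inner_smul_right]
  congr 1
  exact map_smul ρ c _

/-- A product of characteristic functions: the marginal is the true position distribution convolved
with that of $\sigma$. -/
lemma charFun_marginalOne {n : ℕ} {hbar : ℝ} (hpos : 0 < hbar) {σ ρ : Op n} (hσ : IsState σ)
    (hM : IsPOVM (phaseSpaceObservable hbar σ)) (hρ : IsState ρ) (k : Vec n) :
    charFun (law (marginalOne (phaseSpaceObservable hbar σ)) ρ) k =
      stateChar hbar σ (inUpper k) * stateChar hbar ρ (inUpper k) := by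
  have e : marginalOne (phaseSpaceObservable hbar σ) =
      fun A => phaseSpaceObservable hbar σ (Prod.fst ⁻¹' A) := by
    ext1 A
    rw [marginalOne, Set.prod_univ]
  have hT := hasOpIntegral_phaseSpaceObservable hpos hσ hM (inUpper k)
  have e1 : lower (inUpper k) = 0 := rfl
  have e2 : upper (inUpper k) = k := rfl
  simp only [dotProduct_stack, e1, e2, inner_zero_left, add_zero] at hT
  rw [e, charFun_law (hM.hasVectorLaws.preimage measurable_fst) hρ k
    (HasOpIntegral.preimage hM.hasVectorLaws measurable_fst
      (Continuous.measurable (by fun_prop)) hT), opTrace_comp_smul]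
  rfl

lemma charFun_marginalTwo {n : ℕ} {hbar : ℝ} (hpos : 0 < hbar) {σ ρ : Op n} (hσ : IsState σ)
    (hM : IsPOVM (phaseSpaceObservable hbar σ)) (hρ : IsState ρ) (l : Vec n) :
    charFun (law (marginalTwo (phaseSpaceObservable hbar σ)) ρ) l =
      stateChar hbar σ (inLower l) * stateChar hbar ρ (inLower l) := by
  have e : marginalTwo (phaseSpaceObservable hbar σ) =
      fun A => phaseSpaceObservable hbar σ (Prod.snd ⁻¹' A) := by
    ext1 A
    rw [marginalTwo, Set.univ_prod]
  have hT := hasOpIntegral_phaseSpaceObservable hpos hσ hM (inLower l)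
  have e1 : lower (inLower l) = l := rfl
  have e2 : upper (inLower l) = 0 := rfl
  simp only [dotProduct_stack, e1, e2, inner_zero_left, zero_add] at hT
  rw [e, charFun_law (hM.hasVectorLaws.preimage measurable_snd) hρ l
    (HasOpIntegral.preimage hM.hasVectorLaws measurable_snd
      (Continuous.measurable (by fun_prop)) hT), opTrace_comp_smul]
  rfl

lemma isProbabilityMeasure_marginals {n : ℕ} {hbar : ℝ} {σ ρ : Op n}
    (hM : IsPOVM (phaseSpaceObservable hbar σ)) (hρ : IsState ρ) :
    IsProbabilityMeasure (law (marginalOne (phaseSpaceObservable hbar σ)) ρ) ∧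
    IsProbabilityMeasure (law (marginalTwo (phaseSpaceObservable hbar σ)) ρ) := by
  have e : marginalOne (phaseSpaceObservable hbar σ) =
      fun A => phaseSpaceObservable hbar σ (Prod.fst ⁻¹' A) := by
    ext1 A
    rw [marginalOne, Set.prod_univ]
  have e' : marginalTwo (phaseSpaceObservable hbar σ) =
      fun A => phaseSpaceObservable hbar σ (Prod.snd ⁻¹' A) := by
    ext1 A
    rw [marginalTwo, Set.univ_prod]
  rw [e, e']
  exact ⟨(hM.hasVectorLaws.preimage measurable_fst).isProbabilityMeasure_law hρ,
    (hM.hasVectorLaws.preimage measurable_snd).isProbabilityMeasure_law hρ⟩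

open InformationTheory ProbabilityTheory

/-! ### Relative entropy of Gaussian measures -/

section KL

variable {α β : Type*} {mα : MeasurableSpace α} {mβ : MeasurableSpace β}

/-- Data processing applied to the map and to its inverse. -/
lemma klDiv_map_measurableEquiv (e : α ≃ᵐ β) (μ ν : Measure α) [IsFiniteMeasure μ]
    [IsFiniteMeasure ν] : klDiv (μ.map e) (ν.map e) = klDiv μ ν := by
  refine le_antisymm (klDiv_map_le μ ν e.measurable) ?_
  have h := klDiv_map_le (μ.map e) (ν.map e) e.symm.measurable
  rwa [e.map_symm_map, e.map_symm_map] at h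

lemma klDiv_prod_right (μ ν : Measure α) (γ : Measure β) [IsFiniteMeasure μ] [IsFiniteMeasure ν]
    [IsProbabilityMeasure γ] : klDiv (μ.prod γ) (ν.prod γ) = klDiv μ ν := by
  rw [← Measure.compProd_const, ← Measure.compProd_const, klDiv_compProd_left]

/-- The chain rule for constant kernels; its conditional term has the common first factor $\mu_1$,
which drops out after exchanging the coordinates. -/
lemma klDiv_prod (μ₁ ν₁ : Measure α) (μ₂ ν₂ : Measure β) [IsProbabilityMeasure μ₁]
    [IsProbabilityMeasure ν₁] [IsProbabilityMeasure μ₂] [IsProbabilityMeasure ν₂] :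
    klDiv (μ₁.prod μ₂) (ν₁.prod ν₂) = klDiv μ₁ ν₁ + klDiv μ₂ ν₂ := by
  rw [← Measure.compProd_const, ← Measure.compProd_const, klDiv_compProd_eq_add,
    Measure.compProd_const, Measure.compProd_const, ← klDiv_prod_right μ₂ ν₂ μ₁,
    ← klDiv_map_measurableEquiv MeasurableEquiv.prodComm (μ₂.prod μ₁)]
  have e : ∀ κ : Measure β, ∀ [IsProbabilityMeasure κ],
      (κ.prod μ₁).map MeasurableEquiv.prodComm = μ₁.prod κ := fun κ _ => Measure.prod_swap
  rw [e, e]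

lemma klDiv_pi : ∀ {n : ℕ} (μ ν : Fin n → Measure ℝ) [∀ i, IsProbabilityMeasure (μ i)]
    [∀ i, IsProbabilityMeasure (ν i)],
    klDiv (Measure.pi μ) (Measure.pi ν) = ∑ i, klDiv (μ i) (ν i)
  | 0, μ, ν, _, _ => by
    rw [Measure.pi_of_empty μ 0, Measure.pi_of_empty ν 0, klDiv_self]; simp
  | n + 1, μ, ν, _, _ => by
    rw [← klDiv_map_measurableEquiv (MeasurableEquiv.piFinSuccAbove (fun _ : Fin (n + 1) => ℝ) 0),
      (measurePreserving_piFinSuccAbove μ 0).map_eq, (measurePreserving_piFinSuccAbove ν 0).map_eq,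
      klDiv_prod, klDiv_pi, Fin.sum_univ_succ]
    rfl

/-- Adjoining an independent common factor $\gamma$ leaves the relative entropy unchanged, and
addition of the coordinates can only lower it. -/
lemma klDiv_conv_le {n : ℕ} (μ ν γ : Measure (Vec n)) [IsProbabilityMeasure μ]
    [IsProbabilityMeasure ν] [IsProbabilityMeasure γ] : klDiv (μ ∗ γ) (ν ∗ γ) ≤ klDiv μ ν := by
  rw [← klDiv_prod_right μ ν γ]
  exact klDiv_map_le _ _ (by fun_prop)

end KL

open scoped NNReal in
lemma klDiv_gaussianReal (m m' : ℝ) {v v' : ℝ≥0} (hv : v ≠ 0) (hv' : v' ≠ 0) :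
    klDiv (gaussianReal m v) (gaussianReal m' v') =
      ENNReal.ofReal (1 / 2 * (Real.log (v' / v) + v / v' - 1 + (m' - m) ^ 2 / v')) := by
  have hac : gaussianReal m v ≪ gaussianReal m' v' :=
    (gaussianReal_absolutelyContinuous m hv).trans (gaussianReal_absolutelyContinuous' m' hv')
  have hvp : (0 : ℝ) < v := by positivity
  have hvp' : (0 : ℝ) < v' := by positivity
  -- The log-likelihood ratio is a quadratic polynomial in $x-m$, so its mean requires only the
  -- first two central moments.
  have hllr : llr (gaussianReal m v) (gaussianReal m' v') =ᵐ[gaussianReal m v] fun x =>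
      (1 / 2 * Real.log (v' / v) + (m' - m) ^ 2 / (2 * v')) +
        ((m - m') / v' * (x - m) + (1 / (2 * v') - 1 / (2 * v)) * (x - m) ^ 2) := by
    have h1 := (gaussianReal_absolutelyContinuous m hv).ae_le
      (Measure.rnDeriv_mul_rnDeriv (κ := volume) hac)
    have h2 := (gaussianReal_absolutelyContinuous m hv).ae_le (rnDeriv_gaussianReal m v)
    have h3 := (gaussianReal_absolutelyContinuous m hv).ae_le (rnDeriv_gaussianReal m' v')
    filter_upwards [h1, h2, h3] with x e1 e2 e3
    rw [Pi.mul_apply, e2, e3] at e1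
    have e4 := congrArg ENNReal.toReal e1
    rw [ENNReal.toReal_mul, toReal_gaussianPDF, toReal_gaussianPDF] at e4
    have p1 := gaussianPDFReal_pos m v x hv
    have p2 := gaussianPDFReal_pos m' v' x hv'
    rw [llr, eq_div_of_mul_eq p2.ne' e4, Real.log_div p1.ne' p2.ne', gaussianPDFReal,
      gaussianPDFReal, Real.log_mul (by positivity) (Real.exp_ne_zero _),
      Real.log_mul (by positivity) (Real.exp_ne_zero _), Real.log_exp, Real.log_exp, Real.log_inv,
      Real.log_inv, Real.log_sqrt (by positivity), Real.log_sqrt (by positivity),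
      Real.log_mul (by positivity) hvp.ne', Real.log_mul (by positivity) hvp'.ne',
      Real.log_div hvp'.ne' hvp.ne']
    field_simp
    ring
  have hL2 : MemLp (fun x => x - m) 2 (gaussianReal m v) :=
    (memLp_id_gaussianReal 2).sub (memLp_const m)
  have i1 : Integrable (fun x => x - m) (gaussianReal m v) := hL2.integrable (by norm_num)
  have i2 : Integrable (fun x => (x - m) ^ 2) (gaussianReal m v) := hL2.integrable_sq
  have s1 : ∫ x, x - m ∂(gaussianReal m v) = 0 := by
    have hid : Integrable (fun x => x) (gaussianReal m v) :=
      (memLp_id_gaussianReal 1).integrable (by norm_num)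
    rw [integral_sub hid (integrable_const m), integral_id_gaussianReal]
    simp
  have s2 : ∫ x, (x - m) ^ 2 ∂(gaussianReal m v) = v := by
    have h := variance_fun_id_gaussianReal (μ := m) (v := v)
    rwa [variance_eq_integral (by fun_prop), integral_id_gaussianReal] at h
  have i3 : Integrable (fun x => (m - m') / v' * (x - m)) (gaussianReal m v) := i1.const_mul _
  have i4 : Integrable (fun x => (1 / (2 * v') - 1 / (2 * v)) * (x - m) ^ 2) (gaussianReal m v) :=
    i2.const_mul _
  have i5 : Integrable (fun x => (m - m') / v' * (x - m) +
    (1 / (2 * v') - 1 / (2 * v)) * (x - m) ^ 2) (gaussianReal m v) := i3.add i4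
  rw [klDiv_of_ac_of_integrable hac (((integrable_const _).add i5).congr hllr.symm),
    integral_congr_ae hllr, integral_add (integrable_const _) i5, integral_add i3 i4,
    integral_const_mul, integral_const_mul, s1, s2]
  congr 1
  simp
  field_simp
  ring

/-! ### Multivariate Gaussians in an orthonormal eigenbasis. -/

section Diagonalisation

variable {n : ℕ} (B : OrthonormalBasis (Fin n) ℝ (Vec n))

lemma dotProduct_mulVec_eq_sum {R : Matrix (Fin n) (Fin n) ℝ} (hR : Rᵀ = R) {r : Fin n → ℝ}
    (hB : ∀ i, R *ᵥ (B i) = r i • (B i : Fin n → ℝ)) (x : Vec n) :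
    x ⬝ᵥ R *ᵥ x = ∑ i, r i * B.repr x i ^ 2 := by
  have hin : ∀ u v : Vec n, inner ℝ u v = u ⬝ᵥ v := fun u v => by
    simp [PiLp.inner_apply, dotProduct, mul_comm]
  have e1 : x ⬝ᵥ R *ᵥ x = inner ℝ x (WithLp.toLp 2 (R *ᵥ x) : Vec n) := by rw [hin]
  rw [e1, ← B.sum_inner_mul_inner]
  refine Finset.sum_congr rfl fun i _ => ?_
  have e2 : inner ℝ (B i) (WithLp.toLp 2 (R *ᵥ x) : Vec n) = r i * inner ℝ (B i) x := by
    rw [hin, hin]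
    change B i ⬝ᵥ R *ᵥ x = _
    rw [dotProduct_mulVec, ← mulVec_transpose, hR, hB, smul_dotProduct, smul_eq_mul]
  rw [e2, real_inner_comm, B.repr_apply_apply]
  ring

open scoped NNReal in
-- In an eigenbasis of the variance matrix the coordinates are independent. The basis is a
-- parameter, so that two Gaussians with commuting variances can be transported by the same map.
lemma multivariateGaussian_eq_map {R : Matrix (Fin n) (Fin n) ℝ} (hR : R.PosSemidef) {r : Fin n → ℝ≥0}
    (hB : ∀ i, R *ᵥ (B i) = (r i : ℝ) • (B i : Fin n → ℝ)) (x : Vec n) :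
    multivariateGaussian x R =
      (Measure.pi fun i => gaussianReal (B.repr x i) (r i)).map
        ((MeasurableEquiv.toLp 2 (Fin n → ℝ)).trans B.repr.symm.toMeasurableEquiv) := by
  have hm : Measurable B.repr.symm := B.repr.symm.continuous.measurable
  have hcoe : ⇑((MeasurableEquiv.toLp 2 (Fin n → ℝ)).trans B.repr.symm.toMeasurableEquiv) =
      B.repr.symm ∘ WithLp.toLp 2 := rfl
  have : IsProbabilityMeasure ((Measure.pi fun i => gaussianReal (B.repr x i) (r i)).map
      ((MeasurableEquiv.toLp 2 (Fin n → ℝ)).trans B.repr.symm.toMeasurableEquiv)) :=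
    Measure.isProbabilityMeasure_map (MeasurableEquiv.measurable _).aemeasurable
  refine Measure.ext_of_charFun (funext fun t => ?_)
  rw [charFun_multivariateGaussian hR, hcoe, ← Measure.map_map hm (by fun_prop), charFun_apply,
    integral_map hm.aemeasurable (by fun_prop)]
  have e : ∀ y, inner ℝ (B.repr.symm y) t = inner ℝ y (B.repr t) := fun y => by
    rw [← B.repr.inner_map_map, LinearIsometryEquiv.apply_symm_apply]
  simp only [e]
  rw [← charFun_apply, charFun_pi]
  simp only [charFun_gaussianReal]
  rw [← Complex.exp_sum, Finset.sum_sub_distrib, ← B.repr.inner_map_map t x]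
  have hRt : Rᵀ = R := (conjTranspose_eq_transpose_of_trivial R).symm.trans hR.isHermitian
  have e2 := dotProduct_mulVec_eq_sum B hRt hB t
  congr 2
  · rw [PiLp.inner_apply, Complex.ofReal_sum, Finset.sum_mul]
    refine Finset.sum_congr rfl fun i _ => ?_
    simp [mul_comm]
  · rw [e2, Complex.ofReal_sum, Finset.sum_div]
    refine Finset.sum_congr rfl fun i _ => ?_
    push_cast
    rfl

end Diagonalisation

lemma trace_cfc_eq_sum {n : ℕ} {T : Matrix (Fin n) (Fin n) ℝ} (hT : T.IsHermitian) (f : ℝ → ℝ) :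
    (cfc f T).trace = ∑ i, f (hT.eigenvalues i) := by
  rw [hT.cfc_eq, Matrix.IsHermitian.cfc, Unitary.conjStarAlgAut_apply, trace_mul_comm, ← mul_assoc,
    Unitary.coe_star_mul_self, one_mul, trace_diagonal]
  rfl

/-- The value in nats of the relative entropy of the Gaussian measure with variance `ε1` with
respect to its convolution with the Gaussian measure with mean `b` and variance `S`. -/
def gaussianEntropy {n : ℕ} (S : Matrix (Fin n) (Fin n) ℝ) (b : Fin n → ℝ) (ε : ℝ) : ℝ :=
  1 / 2 * ((cfc sFun (ε⁻¹ • S)).trace + b ⬝ᵥ ((S + ε • 1)⁻¹ *ᵥ b))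

lemma sFun_nonneg {x : ℝ} (hx : 0 ≤ x) : 0 ≤ sFun x := by
  have h := Real.one_sub_inv_le_log_of_pos (show 0 < 1 + x by linarith)
  have e : x / (1 + x) = 1 - (1 + x)⁻¹ := by field_simp; ring
  rw [sFun, e]
  linarith

lemma posDef_add_smul_one {n : ℕ} {S : Matrix (Fin n) (Fin n) ℝ} (hS : S.PosSemidef) {ε : ℝ}
    (hε : 0 < ε) : (S + ε • 1).PosDef :=
  Matrix.PosDef.posSemidef_add hS (Matrix.PosDef.one.smul hε)

/-- The matrix $\varepsilon1$ commutes with $S$, so an eigenbasis of $S/\varepsilon$ turns both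
measures into products, with variances $\varepsilon$ and $\varepsilon(1+\nu_i)$. Each coordinate
contributes $\ln(1+\nu_i)+(1+\nu_i)^{-1}-1=s(\nu_i)$ and a mean term. Nonnegativity is recorded
because `ENNReal.ofReal` truncates. -/
lemma klDiv_multivariateGaussian {n : ℕ} {S : Matrix (Fin n) (Fin n) ℝ} (hS : S.PosSemidef)
    {ε : ℝ} (hε : 0 < ε) (a b : Vec n) :
    0 ≤ gaussianEntropy S b ε ∧
    klDiv (multivariateGaussian a (ε • 1)) (multivariateGaussian (a + b) (S + ε • 1)) =
      ENNReal.ofReal (gaussianEntropy S b ε) := by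
  have hT : (ε⁻¹ • S).PosSemidef := hS.smul (inv_nonneg.2 hε.le)
  set B := hT.isHermitian.eigenvectorBasis with hBdef
  set ν := hT.isHermitian.eigenvalues with hν
  have hν0 : ∀ i, 0 ≤ ν i := hT.eigenvalues_nonneg
  let r : Fin n → NNReal := fun i => ⟨ε * (1 + ν i), by have := hν0 i; positivity⟩
  let r₀ : Fin n → NNReal := fun i => ⟨ε, hε.le⟩
  have hr : ∀ i, 0 < ε * (1 + ν i) := fun i => by have := hν0 i; positivity
  have hR : (S + ε • 1).PosDef := posDef_add_smul_one hS hε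
  have hSB : ∀ i, S *ᵥ (B i) = (ε * ν i) • (B i : Fin n → ℝ) := by
    intro i
    have h := hT.isHermitian.mulVec_eigenvectorBasis i
    rw [smul_mulVec, inv_smul_eq_iff₀ hε.ne', smul_smul] at h
    exact h
  have hRB : ∀ i, (S + ε • 1) *ᵥ (B i) = (ε * (1 + ν i)) • (B i : Fin n → ℝ) := by
    intro i
    rw [add_mulVec, hSB, smul_mulVec, one_mulVec]
    module
  have hRiB : ∀ i, (S + ε • 1)⁻¹ *ᵥ (B i) = (ε * (1 + ν i))⁻¹ • (B i : Fin n → ℝ) := by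
    intro i
    have hu : IsUnit (S + ε • (1 : Matrix (Fin n) (Fin n) ℝ)).det :=
      (Matrix.isUnit_iff_isUnit_det _).1 hR.isUnit
    rw [eq_inv_smul_iff₀ (hr i).ne', ← mulVec_smul, ← hRB, mulVec_mulVec, nonsing_inv_mul _ hu,
      one_mulVec]
  have hRi : ((S + ε • (1 : Matrix (Fin n) (Fin n) ℝ))⁻¹)ᵀ = (S + ε • 1)⁻¹ := by
    have : (S + ε • (1 : Matrix (Fin n) (Fin n) ℝ))ᵀ = S + ε • 1 :=
      (conjTranspose_eq_transpose_of_trivial _).symm.trans hR.isHermitian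
    rw [transpose_nonsing_inv, this]
  have hval : gaussianEntropy S b ε =
      ∑ i, 1 / 2 * (sFun (ν i) + (B.repr b i) ^ 2 / (ε * (1 + ν i))) := by
    rw [gaussianEntropy, trace_cfc_eq_sum hT.isHermitian, dotProduct_mulVec_eq_sum B hRi hRiB,
      ← Finset.sum_add_distrib, Finset.mul_sum]
    refine Finset.sum_congr rfl fun i _ => ?_
    ring
  have hterm : ∀ i, 0 ≤ 1 / 2 * (sFun (ν i) + (B.repr b i) ^ 2 / (ε * (1 + ν i))) := fun i => by
    have h1 := sFun_nonneg (hν0 i)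
    have h2 := hr i
    positivity
  refine ⟨hval ▸ Finset.sum_nonneg fun i _ => hterm i, ?_⟩
  have h1 : (ε • (1 : Matrix (Fin n) (Fin n) ℝ)).PosSemidef :=
    Matrix.PosSemidef.one.smul hε.le
  rw [multivariateGaussian_eq_map B h1 (r := r₀)
      (fun i => by rw [smul_mulVec, one_mulVec]; rfl) a,
    multivariateGaussian_eq_map B hR.posSemidef (r := r) hRB (a + b),
    klDiv_map_measurableEquiv, klDiv_pi, hval, ENNReal.ofReal_sum_of_nonneg fun i _ => hterm i]
  refine Finset.sum_congr rfl fun i _ => ?_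
  have hr0' : r₀ i ≠ 0 := fun h => hε.ne' (congrArg NNReal.toReal h)
  have hr' : r i ≠ 0 := fun h => (hr i).ne' (congrArg NNReal.toReal h)
  rw [klDiv_gaussianReal _ _ hr0' hr']
  change ENNReal.ofReal (1 / 2 * (Real.log (ε * (1 + ν i) / ε) + ε / (ε * (1 + ν i)) - 1 +
    (B.repr (a + b) i - B.repr a i) ^ 2 / (ε * (1 + ν i)))) = _
  have h3 : 1 + ν i ≠ 0 := by have := hν0 i; positivity
  rw [map_add, PiLp.add_apply, add_sub_cancel_left, mul_div_cancel_left₀ _ hε.ne', sFun]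
  congr 2
  field_simp
  ring

lemma conv_multivariateGaussian {n : ℕ} {S R : Matrix (Fin n) (Fin n) ℝ} (hS : S.PosSemidef)
    (hR : R.PosSemidef) (a b : Vec n) :
    multivariateGaussian a S ∗ multivariateGaussian b R = multivariateGaussian (a + b) (S + R) := by
  refine Measure.ext_of_charFun (funext fun t => ?_)
  rw [charFun_conv, charFun_multivariateGaussian hS, charFun_multivariateGaussian hR,
    charFun_multivariateGaussian (hS.add hR), ← Complex.exp_add, add_mulVec, dotProduct_add,
    inner_add_right]
  congr 1
  push_cast
  ring

/-- Among the Gaussian measures with variance `A ≥ ε1`, the relative entropy with respect to the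
convolution with a fixed Gaussian measure is largest for `A = ε1`. -/
lemma klDiv_multivariateGaussian_le {n : ℕ} {S A : Matrix (Fin n) (Fin n) ℝ} (hS : S.PosSemidef)
    {ε : ℝ} (hε : 0 < ε) (hA : (A - ε • 1).PosSemidef) (a b : Vec n) :
    klDiv (multivariateGaussian a A) (multivariateGaussian (a + b) (A + S)) ≤
      ENNReal.ofReal (gaussianEntropy S b ε) := by
  have h1 : (ε • (1 : Matrix (Fin n) (Fin n) ℝ)).PosSemidef :=
    Matrix.PosSemidef.one.smul hε.le
  -- The excess variance $A-\varepsilon1\ge0$ is split off as a Gaussian convolved with both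
  -- measures; the whole mean $a$ goes with it, so the remaining pair no longer depends on $a$ or
  -- $A$.
  have e1 : multivariateGaussian a A =
      multivariateGaussian 0 (ε • 1) ∗ multivariateGaussian a (A - ε • 1) := by
    rw [conv_multivariateGaussian h1 hA, zero_add, add_sub_cancel]
  have e2 : multivariateGaussian (a + b) (A + S) =
      multivariateGaussian (0 + b) (S + ε • 1) ∗ multivariateGaussian a (A - ε • 1) := by
    rw [conv_multivariateGaussian (hS.add h1) hA]
    congr 1
    · abel
    · abel
  rw [e1, e2, ← (klDiv_multivariateGaussian hS hε 0 b).2]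
  exact klDiv_conv_le _ _ _

/-! ### Mixtures of pure states -/

section Mixture

variable {n : ℕ} {X : Type} [TopologicalSpace X] [SecondCountableTopology X] [MeasurableSpace X]
  [BorelSpace X]

/-- The mixture `∫ |Ψ(p)⟩⟨Ψ(p)| γ(dp)`. -/
def mixture (γ : Measure X) (Ψ : X → Hil n) : Op n :=
  ∫ p, InnerProductSpace.rankOne ℂ (Ψ p) (Ψ p) ∂γ

variable {γ : Measure X} [IsProbabilityMeasure γ] {Ψ : X → Hil n}

lemma inner_mixture (hΨ : Continuous Ψ) (hnorm : ∀ p, ‖Ψ p‖ = 1) (φ χ : Hil n) :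
    inner ℂ φ (mixture γ Ψ χ) = ∫ p, inner ℂ φ (Ψ p) * inner ℂ (Ψ p) χ ∂γ := by
  have hc : Continuous fun p => (InnerProductSpace.rankOne ℂ (Ψ p) (Ψ p) : Op n) :=
    ((ContinuousLinearMap.toSpanSingletonCLE (𝕜 := ℂ) (E := Hil n)).continuous.comp hΨ).clm_comp
      ((innerSL ℂ).continuous.comp hΨ)
  have hi : Integrable (fun p => (InnerProductSpace.rankOne ℂ (Ψ p) (Ψ p) : Op n)) γ := by
    refine Integrable.of_bound (C := 1) hc.aestronglyMeasurable
      (Filter.Eventually.of_forall fun p => ?_)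
    simp [hnorm]
  rw [mixture, ContinuousLinearMap.integral_apply hi, ← integral_inner
    (hi.apply_continuousLinearMap χ)]
  refine integral_congr_ae (Filter.Eventually.of_forall fun p => ?_)
  simp only [InnerProductSpace.rankOne_apply]
  rw [inner_smul_right, mul_comm]

lemma isPositive_mixture (hΨ : Continuous Ψ) (hnorm : ∀ p, ‖Ψ p‖ = 1) :
    (mixture γ Ψ).IsPositive := by
  rw [ContinuousLinearMap.isPositive_iff_complex]
  intro χ
  have e : inner ℂ (mixture γ Ψ χ) χ = ((∫ p, ‖inner ℂ (Ψ p) χ‖ ^ 2 ∂γ : ℝ) : ℂ) := by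
    rw [← inner_conj_symm, inner_mixture hΨ hnorm, ← integral_conj, ← integral_complex_ofReal]
    refine integral_congr_ae (Filter.Eventually.of_forall fun p => ?_)
    simp only [map_mul]
    rw [inner_conj_symm, mul_comm]
    exact (Complex.conj_mul' _).trans (Complex.ofReal_pow _ _).symm
  rw [e]
  refine ⟨by simp, ?_⟩
  simpa using integral_nonneg fun p => by positivity

/-- The trace against a mixture is the average of the pure-state expectations: Parseval for each
$p$, with sum and integral exchanged. -/
lemma hasSum_mixture (hΨ : Continuous Ψ) (hnorm : ∀ p, ‖Ψ p‖ = 1) (T : Op n) :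
    HasSum (fun i => inner ℂ (basis n i) (mixture γ Ψ (T (basis n i))))
      (∫ p, inner ℂ (Ψ p) (T (Ψ p)) ∂γ) := by
  set b := basis n
  set T' := ContinuousLinearMap.adjoint T
  simp only [inner_mixture hΨ hnorm]
  -- The dominating series: $|uv|\le\frac12(|u|^2+|v|^2)$ with $T$ moved to the other side as its
  -- adjoint; Parseval sums it uniformly in $p$.
  have hb : ∀ p, HasSum (fun i => (1 / 2 : ℝ) * (‖inner ℂ (b i) (T' (Ψ p))‖ ^ 2 +
      ‖inner ℂ (b i) (Ψ p)‖ ^ 2)) (1 / 2 * (‖T' (Ψ p)‖ ^ 2 + ‖Ψ p‖ ^ 2)) := fun p =>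
    ((hasSum_norm_inner_sq b (T' (Ψ p))).add (hasSum_norm_inner_sq b (Ψ p))).mul_left _
  refine hasSum_integral_of_dominated_convergence
    (fun i p => 1 / 2 * (‖inner ℂ (b i) (T' (Ψ p))‖ ^ 2 + ‖inner ℂ (b i) (Ψ p)‖ ^ 2))
    (fun i => Continuous.aestronglyMeasurable (by fun_prop))
    (fun i => Filter.Eventually.of_forall fun p => ?_)
    (Filter.Eventually.of_forall fun p => (hb p).summable) ?_
    (Filter.Eventually.of_forall fun p => ?_)
  · have e : ‖inner ℂ (Ψ p) (T (b i))‖ = ‖inner ℂ (b i) (T' (Ψ p))‖ := by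
      rw [ContinuousLinearMap.adjoint_inner_right, norm_inner_symm]
    rw [norm_mul, e]
    nlinarith [sq_nonneg (‖inner ℂ (b i) (T' (Ψ p))‖ - ‖inner ℂ (b i) (Ψ p)‖)]
  · simp only [(hb _).tsum_eq]
    refine Integrable.of_bound (C := 1 / 2 * (‖T'‖ ^ 2 + 1))
      (Continuous.aestronglyMeasurable (by fun_prop)) (Filter.Eventually.of_forall fun p => ?_)
    rw [Real.norm_of_nonneg (by positivity), hnorm, one_pow]
    have h := T'.le_opNorm (Ψ p)
    rw [hnorm, mul_one] at h
    gcongr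
  · have h := b.hasSum_inner_mul_inner (T' (Ψ p)) (Ψ p)
    rw [ContinuousLinearMap.adjoint_inner_left] at h
    have e : (fun i => inner ℂ (b i) (Ψ p) * inner ℂ (Ψ p) (T (b i))) =
        fun i => inner ℂ (T' (Ψ p)) (b i) * inner ℂ (b i) (Ψ p) := by
      ext i
      rw [ContinuousLinearMap.adjoint_inner_left, mul_comm]
    rw [e]
    exact h

lemma isState_mixture (hΨ : Continuous Ψ) (hnorm : ∀ p, ‖Ψ p‖ = 1) : IsState (mixture γ Ψ) := by
  refine ⟨isPositive_mixture hΨ hnorm, ?_⟩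
  have h := hasSum_mixture (γ := γ) hΨ hnorm (1 : Op n)
  have e : ∀ p, inner ℂ (Ψ p) ((1 : Op n) (Ψ p)) = 1 := fun p => by
    rw [one_apply_eq_self, inner_self_eq_norm_sq_to_K, hnorm]; simp
  simp only [e] at h
  simpa using h

end Mixture

/-! ### Gaussian wave functions -/

/-- The function `y ↦ exp(-‖y‖²/(4ε))`. -/
def gaussFun {n : ℕ} (ε : ℝ) (y : Vec n) : ℂ := Complex.exp (-(‖y‖ ^ 2 / (4 * ε) : ℝ))

lemma integral_exp_neg_sq {n : ℕ} {ε : ℝ} (hε : 0 < ε) (q : Vec n) :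
    ∫ v : Vec n, Complex.exp (-(‖v‖ ^ 2 / (2 * ε) : ℝ) + ((inner ℝ q v : ℝ) : ℂ) * Complex.I) =
      ((Real.pi * (2 * ε) : ℝ) : ℂ) ^ ((n : ℂ) / 2) * Complex.exp (-(ε * ‖q‖ ^ 2 / 2 : ℝ)) := by
  have hb : 0 < (((2 * ε)⁻¹ : ℝ) : ℂ).re := by rw [Complex.ofReal_re]; positivity
  have h := GaussianFourier.integral_cexp_neg_mul_sq_norm_add hb Complex.I q
  rw [finrank_euclideanSpace, Fintype.card_fin] at h
  have e : ∀ v : Vec n, Complex.exp (-(‖v‖ ^ 2 / (2 * ε) : ℝ) + ((inner ℝ q v : ℝ) : ℂ) * Complex.I)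
      = Complex.exp (-(((2 * ε)⁻¹ : ℝ) : ℂ) * ‖v‖ ^ 2 + Complex.I * (inner ℝ q v : ℝ)) := fun v => by
    congr 1
    push_cast
    ring
  simp only [e]
  rw [h]
  congr 2
  · push_cast
    rw [div_inv_eq_mul]
  · push_cast
    rw [Complex.I_sq]
    field_simp
    norm_num

lemma memLp_gaussFun {n : ℕ} {ε : ℝ} (hε : 0 < ε) :
    MemLp (gaussFun ε : Vec n → ℂ) 2 (volume : Measure (Vec n)) := by
  have hc : Continuous (gaussFun ε : Vec n → ℂ) := by unfold gaussFun; fun_prop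
  rw [memLp_two_iff_integrable_sq_norm hc.aestronglyMeasurable]
  have hb : 0 < (((2 * ε)⁻¹ : ℝ) : ℂ).re := by rw [Complex.ofReal_re]; positivity
  have h := (GaussianFourier.integrable_cexp_neg_mul_sq_norm_add hb 0 (0 : Vec n)).norm
  refine h.congr (Filter.Eventually.of_forall fun v => ?_)
  simp only [gaussFun, zero_mul, add_zero]
  rw [Complex.norm_exp, Complex.norm_exp, ← Real.exp_nat_mul]
  congr 1
  rw [← Complex.ofReal_pow, ← Complex.ofReal_neg, ← Complex.ofReal_mul, ← Complex.ofReal_neg,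
    Complex.ofReal_re, Complex.ofReal_re]
  push_cast
  field_simp
  ring

lemma inner_weyl_gaussFun {n : ℕ} {hbar ε : ℝ} (hε : 0 < ε) (x q : Vec n) :
    inner ℂ ((memLp_gaussFun hε).toLp (gaussFun ε))
        (weyl hbar x q ((memLp_gaussFun hε).toLp (gaussFun ε))) =
      ((Real.pi * (2 * ε) : ℝ) : ℂ) ^ ((n : ℂ) / 2) *
        Complex.exp (-(‖x‖ ^ 2 / (8 * ε) + ε * ‖hbar⁻¹ • q‖ ^ 2 / 2 : ℝ)) := by
  set G := (memLp_gaussFun (n := n) hε).toLp (gaussFun ε)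
  have e1 : inner ℂ G (weyl hbar x q G) =
      ∫ y, gaussFun ε y * (weylPhase hbar x q y * gaussFun ε (y - x)) := by
    rw [L2.inner_def]
    refine integral_congr_ae ?_
    filter_upwards [(memLp_gaussFun (n := n) hε).coeFn_toLp, weyl_coe hbar x q G,
      ae_comp_sub (memLp_gaussFun (n := n) hε).coeFn_toLp x] with y h1 h2 h3
    rw [h1, h2, h3, RCLike.inner_apply, mul_comm]
    congr 1
    rw [gaussFun, ← Complex.exp_conj, ← Complex.ofReal_neg, Complex.conj_ofReal]
  -- Centring at $x/2$ cancels the cross terms of the two Gaussians and the phase $x\cdot q/2$.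
  rw [e1, ← integral_add_right_eq_self _ ((1 / 2 : ℝ) • x)]
  have e2 : ∀ v : Vec n, gaussFun ε (v + (1 / 2 : ℝ) • x) *
      (weylPhase hbar x q (v + (1 / 2 : ℝ) • x) * gaussFun ε (v + (1 / 2 : ℝ) • x - x)) =
      Complex.exp (-(‖x‖ ^ 2 / (8 * ε) : ℝ)) * Complex.exp (-(‖v‖ ^ 2 / (2 * ε) : ℝ) +
        ((inner ℝ (hbar⁻¹ • q) v : ℝ) : ℂ) * Complex.I) := by
    intro v
    have n1 : ‖v + (1 / 2 : ℝ) • x‖ ^ 2 = ‖v‖ ^ 2 + inner ℝ v x + ‖x‖ ^ 2 / 4 := by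
      rw [norm_add_sq_real, inner_smul_right, norm_smul]
      norm_num
      ring
    have n2 : ‖v + (1 / 2 : ℝ) • x - x‖ ^ 2 = ‖v‖ ^ 2 - inner ℝ v x + ‖x‖ ^ 2 / 4 := by
      rw [show v + (1 / 2 : ℝ) • x - x = v - (1 / 2 : ℝ) • x by module, norm_sub_sq_real,
        inner_smul_right, norm_smul]
      norm_num
      ring
    rw [gaussFun, gaussFun, weylPhase, n1, n2, inner_add_right, inner_smul_right,
      real_inner_comm q x, inner_smul_left, ← Complex.exp_add, ← Complex.exp_add, ← Complex.exp_add]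
    congr 1
    simp
    field_simp
    ring
  simp only [e2]
  rw [integral_const_mul, integral_exp_neg_sq hε, mul_left_comm, ← Complex.exp_add]
  congr 2
  push_cast
  ring

/-- The exponent exhibits position variance $\varepsilon$ and, with $x=-\hbar l$, momentum variance
$\hbar^2/(4\varepsilon)$: a minimum uncertainty vector. -/
lemma exists_gaussian_vector {n : ℕ} (hbar : ℝ) {ε : ℝ} (hε : 0 < ε) :
    ∃ ψ : Hil n, ∀ x q : Vec n, inner ℂ ψ (weyl hbar x q ψ) =
      Complex.exp (-(‖x‖ ^ 2 / (8 * ε) + ε * ‖hbar⁻¹ • q‖ ^ 2 / 2 : ℝ)) := by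
  set G := (memLp_gaussFun (n := n) hε).toLp (gaussFun ε)
  set K := ((Real.pi * (2 * ε) : ℝ) : ℂ) ^ ((n : ℂ) / 2)
  have hpos : (0 : ℝ) < Real.pi * (2 * ε) := by positivity
  have hK : K ≠ 0 := by
    rw [Ne, Complex.cpow_eq_zero_iff, Complex.ofReal_eq_zero]
    exact fun h => hpos.ne' h.1
  have hG : ((‖G‖ : ℝ) : ℂ) ^ 2 = K := by
    have h := inner_weyl_gaussFun (n := n) (hbar := hbar) hε 0 0
    rw [weyl_zero, inner_self_eq_norm_sq_to_K] at h
    refine h.trans ?_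
    simp [K]
  refine ⟨((‖G‖⁻¹ : ℝ) : ℂ) • G, fun x q => ?_⟩
  rw [map_smul, inner_smul_left, inner_smul_right, inner_weyl_gaussFun hε, Complex.conj_ofReal,
    ← mul_assoc, ← mul_assoc, show ((Real.pi * (2 * ε) : ℝ) : ℂ) ^ ((n : ℂ) / 2) = _ from hG.symm]
  have hG0 : ((‖G‖ : ℝ) : ℂ) ≠ 0 := fun h => hK (by rw [← hG, h]; simp)
  push_cast
  field_simp

/-! ### Gaussian states with given scalar variances -/

/-- The phase-space matrix with diagonal blocks `ε1` and `δ1`. -/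
def scalarBlocks (n : ℕ) (ε δ : ℝ) : PhaseMat n n := Matrix.fromBlocks (ε • 1) 0 0 (δ • 1)

/-- The Schur complement of the block $\varepsilon1$ is $(\delta-\hbar^2/(4\varepsilon))1$. -/
lemma posSemidef_complexPair_scalarBlocks {n : ℕ} {hbar ε δ : ℝ} (hε : 0 < ε)
    (hδ : hbar ^ 2 / (4 * ε) ≤ δ) :
    (complexPair (scalarBlocks n ε δ) (Omega hbar n)).PosSemidef := by
  have e : complexPair (scalarBlocks n ε δ) (Omega hbar n) =
      fromBlocks ((ε : ℂ) • (1 : Matrix (Fin n) (Fin n) ℂ))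
        ((Complex.I / 2 * hbar) • (1 : Matrix (Fin n) (Fin n) ℂ))
        ((Complex.I / 2 * hbar) • (1 : Matrix (Fin n) (Fin n) ℂ))ᴴ
        ((δ : ℂ) • (1 : Matrix (Fin n) (Fin n) ℂ)) := by
    ext i j
    rcases i with i | i <;> rcases j with j | j <;>
      simp [complexPair, scalarBlocks, Omega, Matrix.one_apply] <;> split_ifs <;> try simp [neg_div, neg_mul]
  have hεC : (0 : ℂ) < ε := by exact_mod_cast hε
  have hA : ((ε : ℂ) • (1 : Matrix (Fin n) (Fin n) ℂ)).PosDef := Matrix.PosDef.one.smul hεC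
  have hAi : ((ε : ℂ) • (1 : Matrix (Fin n) (Fin n) ℂ))⁻¹ = (ε : ℂ)⁻¹ • 1 := by
    refine Matrix.inv_eq_right_inv ?_
    rw [smul_mul_smul_comm, mul_one, mul_inv_cancel₀ hεC.ne', one_smul]
  have := hA.isUnit.invertible
  rw [e, Matrix.PosDef.fromBlocks₁₁ _ _ hA, hAi]
  have e' : (δ : ℂ) • (1 : Matrix (Fin n) (Fin n) ℂ) -
      ((Complex.I / 2 * hbar) • (1 : Matrix (Fin n) (Fin n) ℂ))ᴴ * ((ε : ℂ)⁻¹ • 1) *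
        ((Complex.I / 2 * hbar) • (1 : Matrix (Fin n) (Fin n) ℂ)) =
      ((δ - hbar ^ 2 / (4 * ε) : ℝ) : ℂ) • 1 := by
    rw [conjTranspose_smul, conjTranspose_one, smul_mul_smul_comm, smul_mul_smul_comm, mul_one,
      mul_one, ← sub_smul]
    congr 1
    simp only [star_mul', star_div₀, RCLike.star_def, Complex.conj_I, Complex.conj_ofReal, map_ofNat]
    push_cast
    have := hεC.ne'
    field_simp
    linear_combination (4 * (hbar : ℂ) ^ 2) * Complex.I_sq
  rw [e']
  refine Matrix.PosSemidef.one.smul ?_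
  have : (0 : ℝ) ≤ δ - hbar ^ 2 / (4 * ε) := by linarith
  exact_mod_cast this

lemma gaussChar_scalarBlocks {n : ℕ} (ε δ : ℝ) (w : PhaseVec n) :
    gaussChar 0 (scalarBlocks n ε δ) w =
      Complex.exp (-((ε * ‖upper w‖ ^ 2 + δ * ‖lower w‖ ^ 2) / 2 : ℝ)) := by
  have e : w ⬝ᵥ (scalarBlocks n ε δ *ᵥ w) = ε * ‖upper w‖ ^ 2 + δ * ‖lower w‖ ^ 2 := by
    simp only [scalarBlocks, upper, lower, dotProduct, Fintype.sum_sum_type, Matrix.mulVec,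
      EuclideanSpace.norm_sq_eq, Finset.mul_sum]
    simp [Matrix.one_apply, pow_two, mul_left_comm]
  rw [gaussChar, e, dotProduct_zero]
  simp

/-- Momentum kicks $W(0,p)$ do not change the position law of the minimum uncertainty vector, and
kicks distributed as $N(0,\tau1)$ add $\tau$ to its momentum variance. -/
lemma exists_isGaussianState {n : ℕ} {hbar ε δ : ℝ} (hpos : 0 < hbar) (hε : 0 < ε)
    (hδ : hbar ^ 2 / (4 * ε) ≤ δ) :
    ∃ ρ : Op n, IsState ρ ∧ ∀ w, stateChar hbar ρ w = gaussChar 0 (scalarBlocks n ε δ) w := by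
  obtain ⟨ψ, hψ⟩ := exists_gaussian_vector (n := n) hbar hε
  have hψ1 : ‖ψ‖ = 1 := by
    have h := hψ 0 0
    rw [weyl_zero, inner_self_eq_norm_sq_to_K] at h
    simp only [norm_zero, smul_zero] at h
    have h' : ‖ψ‖ ^ 2 = 1 := by
      have : ((‖ψ‖ ^ 2 : ℝ) : ℂ) = ((1 : ℝ) : ℂ) := by
        push_cast
        refine h.trans ?_
        simp
      exact_mod_cast this
    nlinarith [norm_nonneg ψ]
  set Ψ : Vec n → Hil n := fun p => weyl hbar 0 p ψ with hΨdef
  have hnorm : ∀ p, ‖Ψ p‖ = 1 := fun p => by rw [hΨdef]; simp only [norm_weyl, hψ1]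
  -- Continuity is read off from $\|\Psi_p-\Psi_q\|^2=2-2\,\mathrm{Re}\langle\Psi_p,\Psi_q\rangle$
  -- and the explicit overlap.
  have hcont : Continuous Ψ := by
    have hin : ∀ p q, inner ℂ (Ψ p) (Ψ q) =
        Complex.exp (-(ε * ‖hbar⁻¹ • (q - p)‖ ^ 2 / 2 : ℝ)) := fun p q => by
      simp only [hΨdef]
      rw [inner_weyl, weyl_weyl, inner_smul_right, hψ, weylCocycle]
      simp [sub_eq_neg_add]
    refine continuous_iff_continuousAt.2 fun q => ?_
    rw [ContinuousAt, tendsto_iff_norm_sub_tendsto_zero]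
    have e : ∀ p, ‖Ψ p - Ψ q‖ =
        √(2 - 2 * (Complex.exp (-(ε * ‖hbar⁻¹ • (q - p)‖ ^ 2 / 2 : ℝ))).re) := fun p => by
      rw [← hin, ← Real.sqrt_sq (norm_nonneg (Ψ p - Ψ q)), @norm_sub_sq ℂ, hnorm, hnorm]
      congr 1
      simp only [RCLike.re_to_complex]
      ring
    simp only [e]
    have hc : Continuous fun p : Vec n =>
        √(2 - 2 * (Complex.exp (-(ε * ‖hbar⁻¹ • (q - p)‖ ^ 2 / 2 : ℝ))).re) := by fun_prop
    have := hc.tendsto q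
    simpa using this
  -- The momentum variance still missing; it may be $0$, in which case the mixing measure is
  -- degenerate.
  set τ := δ - hbar ^ 2 / (4 * ε)
  have hτ : (τ • (1 : Matrix (Fin n) (Fin n) ℝ)).PosSemidef :=
    Matrix.PosSemidef.one.smul (sub_nonneg.2 hδ)
  refine ⟨mixture (multivariateGaussian 0 (τ • 1)) Ψ, isState_mixture hcont hnorm, fun w => ?_⟩
  set k := upper w
  set l := lower w
  have e : ∀ p, inner ℂ (Ψ p) (weylVec hbar (-(Omega hbar n *ᵥ w)) (Ψ p)) =
      Complex.exp (((inner ℝ p l : ℝ) : ℂ) * Complex.I) *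
        Complex.exp (-(hbar ^ 2 * ‖l‖ ^ 2 / (8 * ε) + ε * ‖k‖ ^ 2 / 2 : ℝ)) := fun p => by
    simp only [hΨdef]
    rw [weylVec_neg_Omega, inner_weyl_conj, hψ]
    congr 2
    · rw [inner_zero_right, inner_neg_left, inner_smul_left, real_inner_comm]
      simp [hpos.ne', l]
    · rw [norm_neg, norm_smul, norm_smul, norm_smul, mul_pow, Real.norm_of_nonneg hpos.le,
        norm_inv, Real.norm_of_nonneg hpos.le, inv_mul_cancel_left₀ hpos.ne']
  rw [stateChar, opTrace]
  refine (hasSum_mixture hcont hnorm _).tsum_eq.trans ?_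
  simp only [e]
  rw [integral_mul_const, ← charFun_apply, charFun_multivariateGaussian hτ, gaussChar_scalarBlocks,
    ← Complex.exp_add]
  have hl : (l : Fin n → ℝ) ⬝ᵥ ((τ • (1 : Matrix (Fin n) (Fin n) ℝ)) *ᵥ l) = τ * ‖l‖ ^ 2 := by
    rw [smul_mulVec, one_mulVec, dotProduct_smul, EuclideanSpace.norm_sq_eq]
    simp [dotProduct, pow_two]
  rw [hl]
  congr 1
  simp only [inner_zero_right, τ]
  push_cast
  have : (ε : ℂ) ≠ 0 := by exact_mod_cast hε.ne'
  field_simp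
  ring

/-! ### Gaussian states have Gaussian position and momentum -/

/-- On real vectors the quadratic form of an antisymmetric matrix vanishes. It serves both
$K=\Omega$ and $K=J\Omega J^T$. -/
lemma posSemidef_of_complexPair {n : ℕ} {V K : PhaseMat n n} (hK : Kᵀ = -K)
    (h : (complexPair V K).PosSemidef) : V.PosSemidef := by
  have hV : V.IsHermitian := by
    ext i j
    have h1 := congrArg Complex.re (h.1.apply i j)
    simpa [complexPair] using h1
  refine Matrix.PosSemidef.of_dotProduct_mulVec_nonneg hV fun x => ?_
  have h2 := h.dotProduct_mulVec_nonneg fun i => ((x i : ℝ) : ℂ)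
  have hKx : x ⬝ᵥ (K *ᵥ x) = 0 := by
    have h3 : x ⬝ᵥ (K *ᵥ x) = x ⬝ᵥ (Kᵀ *ᵥ x) := by
      rw [mulVec_transpose, dotProduct_comm x (x ᵥ* K), ← dotProduct_mulVec]
    rw [hK, neg_mulVec, dotProduct_neg] at h3
    linarith
  have e : star (fun i => ((x i : ℝ) : ℂ)) ⬝ᵥ (complexPair V K *ᵥ fun i => ((x i : ℝ) : ℂ)) =
      ((x ⬝ᵥ (V *ᵥ x) : ℝ) : ℂ) + Complex.I / 2 * ((x ⬝ᵥ (K *ᵥ x) : ℝ) : ℂ) := by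
    simp only [complexPair, dotProduct, Matrix.mulVec, Matrix.add_apply, Matrix.map_apply,
      Matrix.smul_apply, Pi.star_apply, RCLike.star_def, Complex.conj_ofReal, smul_eq_mul,
      Complex.ofReal_sum, Complex.ofReal_mul, Finset.mul_sum, ← Finset.sum_add_distrib]
    refine Finset.sum_congr rfl fun i _ => Finset.sum_congr rfl fun j _ => ?_
    ring
  rw [e, hKx, Complex.ofReal_zero, mul_zero, add_zero] at h2
  simpa using h2

lemma transpose_Omega (hbar : ℝ) (n : ℕ) : (Omega hbar n)ᵀ = -Omega hbar n := by
  simp [Omega, fromBlocks_transpose, fromBlocks_neg]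

lemma posSemidef_toBlocks₁₁ {n : ℕ} {V : PhaseMat n n} (hV : V.PosSemidef) :
    V.toBlocks₁₁.PosSemidef := hV.submatrix Sum.inl

lemma posSemidef_toBlocks₂₂ {n : ℕ} {V : PhaseMat n n} (hV : V.PosSemidef) :
    V.toBlocks₂₂.PosSemidef := hV.submatrix Sum.inr

lemma gaussChar_inUpper {n : ℕ} (μ : PhaseVec n) (V : PhaseMat n n) (k : Vec n) :
    gaussChar μ V (inUpper k) = Complex.exp (((inner ℝ k (upper μ) : ℝ) : ℂ) * Complex.I -
      ((k ⬝ᵥ (V.toBlocks₁₁ *ᵥ k) : ℝ) : ℂ) / 2) := by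
  have e1 : inUpper k ⬝ᵥ μ = inner ℝ k (upper μ) := by
    simp [inUpper, upper, dotProduct, PiLp.inner_apply, mul_comm]
  have e2 : inUpper k ⬝ᵥ (V *ᵥ inUpper k) = k ⬝ᵥ (V.toBlocks₁₁ *ᵥ k) := by
    simp [inUpper, dotProduct, Matrix.mulVec, toBlocks₁₁]
  rw [gaussChar, e1, e2, Complex.ofReal_div, mul_comm Complex.I]
  norm_num

lemma gaussChar_inLower {n : ℕ} (μ : PhaseVec n) (V : PhaseMat n n) (k : Vec n) :
    gaussChar μ V (inLower k) = Complex.exp (((inner ℝ k (lower μ) : ℝ) : ℂ) * Complex.I -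
      ((k ⬝ᵥ (V.toBlocks₂₂ *ᵥ k) : ℝ) : ℂ) / 2) := by
  have e1 : inLower k ⬝ᵥ μ = inner ℝ k (lower μ) := by
    simp [inLower, lower, dotProduct, PiLp.inner_apply, mul_comm]
  have e2 : inLower k ⬝ᵥ (V *ᵥ inLower k) = k ⬝ᵥ (V.toBlocks₂₂ *ᵥ k) := by
    simp [inLower, dotProduct, Matrix.mulVec, toBlocks₂₂]
  rw [gaussChar, e1, e2, Complex.ofReal_div, mul_comm Complex.I]
  norm_num

lemma meanVec_multivariateGaussian {n : ℕ} (a : Vec n) (S : Matrix (Fin n) (Fin n) ℝ) :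
    meanVec (multivariateGaussian a S) = a := by
  ext i
  have h := (EuclideanSpace.proj (𝕜 := ℝ) i).integral_comp_comm
    (IsGaussian.integrable_id (μ := multivariateGaussian a S))
  simp only [id, integral_id_multivariateGaussian] at h
  exact h

lemma varMat_multivariateGaussian {n : ℕ} (a : Vec n) {S : Matrix (Fin n) (Fin n) ℝ}
    (hS : S.PosSemidef) : varMat (multivariateGaussian a S) = S := by
  ext i j
  exact covariance_eval_multivariateGaussian hS i j

/-- The distributions of position and momentum in a state with Gaussian characteristic
function are Gaussian. -/
structure HasGaussianLaws {n : ℕ} (hbar : ℝ) (ρ : Op n) : Prop where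
  posSemidef_posVar : (posVar ρ).PosSemidef
  posSemidef_momVar : (momVar hbar ρ).PosSemidef
  position : law (positionPVM n) ρ = multivariateGaussian (WithLp.toLp 2 (posMean ρ)) (posVar ρ)
  momentum : law (momentumPVM hbar n) ρ =
    multivariateGaussian (WithLp.toLp 2 (momMean hbar ρ)) (momVar hbar ρ)

section

variable {n : ℕ} {hbar : ℝ} {ρ : Op n} {μ : PhaseVec n} {V : PhaseMat n n}

lemma law_position_eq (hpos : 0 < hbar) (hρ : IsState ρ) (hV : V.PosSemidef)
    (h : ∀ w, stateChar hbar ρ w = gaussChar μ V w) :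
    law (positionPVM n) ρ = multivariateGaussian (upper μ) V.toBlocks₁₁ := by
  have := (hasVectorLaws_positionPVM n).isProbabilityMeasure_law hρ
  refine Measure.ext_of_charFun (funext fun k => ?_)
  rw [charFun_position hpos hρ, h, gaussChar_inUpper,
    charFun_multivariateGaussian (posSemidef_toBlocks₁₁ hV)]

lemma law_momentum_eq (hρ : IsState ρ) (hV : V.PosSemidef)
    (h : ∀ w, stateChar hbar ρ w = gaussChar μ V w) :
    law (momentumPVM hbar n) ρ = multivariateGaussian (lower μ) V.toBlocks₂₂ := by
  have := (hasVectorLaws_momentumPVM hbar n).isProbabilityMeasure_law hρ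
  refine Measure.ext_of_charFun (funext fun k => ?_)
  rw [charFun_momentum hρ, h, gaussChar_inLower,
    charFun_multivariateGaussian (posSemidef_toBlocks₂₂ hV)]

lemma posVar_eq (hpos : 0 < hbar) (hρ : IsState ρ) (hV : V.PosSemidef)
    (h : ∀ w, stateChar hbar ρ w = gaussChar μ V w) : posVar ρ = V.toBlocks₁₁ := by
  rw [posVar, law_position_eq hpos hρ hV h, varMat_multivariateGaussian _ (posSemidef_toBlocks₁₁ hV)]

lemma momVar_eq (hρ : IsState ρ) (hV : V.PosSemidef)
    (h : ∀ w, stateChar hbar ρ w = gaussChar μ V w) : momVar hbar ρ = V.toBlocks₂₂ := by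
  rw [momVar, law_momentum_eq hρ hV h, varMat_multivariateGaussian _ (posSemidef_toBlocks₂₂ hV)]

/-- Only $V\ge0$ is required, so this covers $\sigma$, whose $V$ comes from the observable and is
constrained through $J\Omega J^T$ instead of $\Omega$. -/
lemma hasGaussianLaws (hpos : 0 < hbar) (hρ : IsState ρ) (hV : V.PosSemidef)
    (h : ∀ w, stateChar hbar ρ w = gaussChar μ V w) : HasGaussianLaws hbar ρ where
  posSemidef_posVar := by
    rw [posVar_eq hpos hρ hV h]
    exact posSemidef_toBlocks₁₁ hV
  posSemidef_momVar := by
    rw [momVar_eq hρ hV h]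
    exact posSemidef_toBlocks₂₂ hV
  position := by
    rw [posVar_eq hpos hρ hV h, posMean, law_position_eq hpos hρ hV h,
      meanVec_multivariateGaussian]
  momentum := by
    rw [momVar_eq hρ hV h, momMean, law_momentum_eq hρ hV h, meanVec_multivariateGaussian]

lemma IsGaussianState.hasGaussianLaws (hpos : 0 < hbar) (h : IsGaussianState hbar ρ) :
    HasGaussianLaws hbar ρ := by
  obtain ⟨hρ, μ, V, hV, hc⟩ := h
  exact EntropicMUR.hasGaussianLaws hpos hρ (posSemidef_of_complexPair (transpose_Omega _ _) hV) hc

end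

/-! ### The error function on Gaussian states -/

section

variable {n : ℕ} {hbar : ℝ} {σ ρ : Op n}

lemma law_marginalOne_eq (hpos : 0 < hbar) (hσ : IsState σ)
    (hM : IsPOVM (phaseSpaceObservable hbar σ)) (hρ : IsState ρ) (gσ : HasGaussianLaws hbar σ)
    (gρ : HasGaussianLaws hbar ρ) :
    law (marginalOne (phaseSpaceObservable hbar σ)) ρ =
      multivariateGaussian (WithLp.toLp 2 (posMean ρ) + WithLp.toLp 2 (posMean σ))
        (posVar ρ + posVar σ) := by
  have := (isProbabilityMeasure_marginals hM hρ).1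
  refine Measure.ext_of_charFun (funext fun k => ?_)
  rw [charFun_marginalOne hpos hσ hM hρ, ← charFun_position hpos hσ, ← charFun_position hpos hρ,
    ← conv_multivariateGaussian gρ.posSemidef_posVar gσ.posSemidef_posVar, charFun_conv,
    ← gρ.position, ← gσ.position, mul_comm]

lemma law_marginalTwo_eq (hpos : 0 < hbar) (hσ : IsState σ)
    (hM : IsPOVM (phaseSpaceObservable hbar σ)) (hρ : IsState ρ) (gσ : HasGaussianLaws hbar σ)
    (gρ : HasGaussianLaws hbar ρ) :
    law (marginalTwo (phaseSpaceObservable hbar σ)) ρ =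
      multivariateGaussian (WithLp.toLp 2 (momMean hbar ρ) + WithLp.toLp 2 (momMean hbar σ))
        (momVar hbar ρ + momVar hbar σ) := by
  have := (isProbabilityMeasure_marginals hM hρ).2
  refine Measure.ext_of_charFun (funext fun k => ?_)
  rw [charFun_marginalTwo hpos hσ hM hρ, ← charFun_momentum hσ, ← charFun_momentum hρ,
    ← conv_multivariateGaussian gρ.posSemidef_momVar gσ.posSemidef_momVar, charFun_conv,
    ← gρ.momentum, ← gσ.momentum, mul_comm]

lemma logb_two_exp_one_nonneg : 0 ≤ Real.logb 2 (Real.exp 1) :=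
  Real.logb_nonneg (by norm_num) (Real.one_le_exp (by norm_num))

lemma gaussianValue_eq (A B : Matrix (Fin n) (Fin n) ℝ) (a b : Fin n → ℝ) (ε δ : ℝ) :
    gaussianValue A B a b ε δ =
      Real.logb 2 (Real.exp 1) * gaussianEntropy A a ε +
        Real.logb 2 (Real.exp 1) * gaussianEntropy B b δ := by
  rw [gaussianValue, gaussianEntropy, gaussianEntropy, trace_add]
  ring

/-- Position and momentum are bounded separately, so it does not matter here whether a state with
both threshold variances exists. -/
lemma errorFunction_le (hpos : 0 < hbar) (hσ : IsState σ)
    (hM : IsPOVM (phaseSpaceObservable hbar σ)) (gσ : HasGaussianLaws hbar σ) {ε δ : ℝ}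
    (hε : 0 < ε) (hδ : 0 < δ) (hρ : ρ ∈ thresholdStates hbar n ε δ) :
    errorFunction hbar ρ (phaseSpaceObservable hbar σ) ≤ ENNReal.ofReal
      (gaussianValue (posVar σ) (momVar hbar σ) (posMean σ) (momMean hbar σ) ε δ) := by
  obtain ⟨hg, h1, h2⟩ := hρ
  have gρ := hg.hasGaussianLaws hpos
  have n1 := (klDiv_multivariateGaussian gσ.posSemidef_posVar hε 0 (WithLp.toLp 2 (posMean σ))).1
  have n2 :=
    (klDiv_multivariateGaussian gσ.posSemidef_momVar hδ 0 (WithLp.toLp 2 (momMean hbar σ))).1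
  rw [errorFunction, relEntropy, relEntropy, law_marginalOne_eq hpos hσ hM hg.1 gσ gρ,
    law_marginalTwo_eq hpos hσ hM hg.1 gσ gρ, gρ.position, gρ.momentum, gaussianValue_eq,
    ENNReal.ofReal_add (mul_nonneg logb_two_exp_one_nonneg n1)
      (mul_nonneg logb_two_exp_one_nonneg n2),
    ENNReal.ofReal_mul logb_two_exp_one_nonneg, ENNReal.ofReal_mul logb_two_exp_one_nonneg]
  gcongr
  · exact klDiv_multivariateGaussian_le gσ.posSemidef_posVar hε h1 _ _
  · exact klDiv_multivariateGaussian_le gσ.posSemidef_momVar hδ h2 _ _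

lemma errorFunction_eq (hpos : 0 < hbar) (hσ : IsState σ)
    (hM : IsPOVM (phaseSpaceObservable hbar σ)) (gσ : HasGaussianLaws hbar σ) {ε δ : ℝ}
    (hε : 0 < ε) (hδ : 0 < δ) (hg : IsGaussianState hbar ρ) (h1 : posVar ρ = ε • 1)
    (h2 : momVar hbar ρ = δ • 1) :
    0 ≤ gaussianValue (posVar σ) (momVar hbar σ) (posMean σ) (momMean hbar σ) ε δ ∧
    errorFunction hbar ρ (phaseSpaceObservable hbar σ) = ENNReal.ofReal
      (gaussianValue (posVar σ) (momVar hbar σ) (posMean σ) (momMean hbar σ) ε δ) := by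
  have gρ := hg.hasGaussianLaws hpos
  obtain ⟨n1, e1⟩ := klDiv_multivariateGaussian gσ.posSemidef_posVar hε
    (WithLp.toLp 2 (posMean ρ)) (WithLp.toLp 2 (posMean σ))
  obtain ⟨n2, e2⟩ := klDiv_multivariateGaussian gσ.posSemidef_momVar hδ
    (WithLp.toLp 2 (momMean hbar ρ)) (WithLp.toLp 2 (momMean hbar σ))
  have m1 := mul_nonneg logb_two_exp_one_nonneg n1
  have m2 := mul_nonneg logb_two_exp_one_nonneg n2
  refine ⟨by rw [gaussianValue_eq]; exact add_nonneg m1 m2, ?_⟩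
  rw [errorFunction, relEntropy, relEntropy, law_marginalOne_eq hpos hσ hM hg.1 gσ gρ,
    law_marginalTwo_eq hpos hσ hM hg.1 gσ gρ, gρ.position, gρ.momentum, gaussianValue_eq,
    ENNReal.ofReal_add m1 m2, ENNReal.ofReal_mul logb_two_exp_one_nonneg,
    ENNReal.ofReal_mul logb_two_exp_one_nonneg, h1, h2, add_comm (ε • 1), add_comm (δ • 1), e1, e2]

lemma exists_isGaussianState_var {ε δ : ℝ} (hpos : 0 < hbar) (hε : 0 < ε)
    (hδ : hbar ^ 2 / (4 * ε) ≤ δ) :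
    ∃ ρ : Op n, IsGaussianState hbar ρ ∧ posVar ρ = ε • 1 ∧ momVar hbar ρ = δ • 1 := by
  obtain ⟨ρ, hρ, hc⟩ := exists_isGaussianState (n := n) hpos hε hδ
  have hp := posSemidef_complexPair_scalarBlocks (n := n) hε hδ
  have hV := posSemidef_of_complexPair (transpose_Omega _ _) hp
  exact ⟨ρ, ⟨hρ, _, _, hp, hc⟩, posVar_eq hpos hρ hV hc, momVar_eq hρ hV hc⟩

end

end EntropicMUR

end

/-! ### The theorem. -/

theorem mainTheorem4 (n : ℕ) (hbar ε₁ ε₂ : ℝ) (hbar_pos : 0 < hbar) (ε₁_pos : 0 < ε₁)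
    (ε₂_pos : 0 < ε₂) (σ : Op n) (hσ : IsState σ)
    (hM : phaseSpaceObservable hbar σ ∈ gaussianCovariantObservables hbar n) :
    (hbar ^ 2 / 4 ≤ ε₁ * ε₂ →
      (∃ ρ : Op n, IsGaussianState hbar ρ ∧ posVar ρ = ε₁ • 1 ∧ momVar hbar ρ = ε₂ • 1) ∧
      ∀ ρ : Op n, IsGaussianState hbar ρ → posVar ρ = ε₁ • 1 → momVar hbar ρ = ε₂ • 1 →
        ρ ∈ thresholdStates hbar n ε₁ ε₂ ∧
        divergence hbar ε₁ ε₂ (phaseSpaceObservable hbar σ) =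
          errorFunction hbar ρ (phaseSpaceObservable hbar σ) ∧
        (errorFunction hbar ρ (phaseSpaceObservable hbar σ) : EReal) =
          ((gaussianValue (posVar σ) (momVar hbar σ) (posMean σ) (momMean hbar σ)
            ε₁ ε₂ : ℝ) : EReal)) ∧
    (ε₁ * ε₂ < hbar ^ 2 / 4 →
      (∃ ρ : Op n, IsGaussianState hbar ρ ∧ posVar ρ = ε₁ • 1 ∧
        momVar hbar ρ = (hbar ^ 2 / (4 * ε₁)) • 1) ∧
      ∀ ρ : Op n, IsGaussianState hbar ρ → posVar ρ = ε₁ • 1 →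
        momVar hbar ρ = (hbar ^ 2 / (4 * ε₁)) • 1 →
        ρ ∈ thresholdStates hbar n ε₁ ε₂ ∧
        errorFunction hbar ρ (phaseSpaceObservable hbar σ) ≤
          divergence hbar ε₁ ε₂ (phaseSpaceObservable hbar σ) ∧
        (errorFunction hbar ρ (phaseSpaceObservable hbar σ) : EReal) =
          ((gaussianValue (posVar σ) (momVar hbar σ) (posMean σ) (momMean hbar σ)
            ε₁ (hbar ^ 2 / (4 * ε₁)) : ℝ) : EReal)) := by
  have hP : IsPOVM (phaseSpaceObservable hbar σ) := hM.1.1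
  have gσ : HasGaussianLaws hbar σ := by
    obtain ⟨-, μ, V, J, -, hV, -, hT⟩ := hM.2
    have hK : (J * Omega hbar n * Jᵀ)ᵀ = -(J * Omega hbar n * Jᵀ) := by
      rw [transpose_mul, transpose_mul, transpose_transpose, transpose_Omega, Matrix.neg_mul,
        Matrix.mul_neg, Matrix.mul_assoc]
    exact hasGaussianLaws hbar_pos hσ (posSemidef_of_complexPair hK hV)
      fun w => stateChar_eq_gaussChar hbar_pos hσ hP (hT w)
  refine ⟨fun h => ?_, fun h => ?_⟩
  -- The case hypothesis is exactly the existence condition for a state with both threshold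
  -- variances.
  · have hδ : hbar ^ 2 / (4 * ε₁) ≤ ε₂ := by
      rw [div_le_iff₀ (by positivity)]
      linarith
    refine ⟨exists_isGaussianState_var hbar_pos ε₁_pos hδ, fun ρ hg h1 h2 => ?_⟩
    have hmem : ρ ∈ thresholdStates hbar n ε₁ ε₂ :=
      ⟨hg, by rw [h1, sub_self]; exact Matrix.PosSemidef.zero,
        by rw [h2, sub_self]; exact Matrix.PosSemidef.zero⟩
    obtain ⟨hn, he⟩ := errorFunction_eq hbar_pos hσ hP gσ ε₁_pos ε₂_pos hg h1 h2
    refine ⟨hmem, le_antisymm ?_ ?_, ?_⟩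
    · rw [he]
      exact iSup₂_le fun ρ' hρ' => errorFunction_le hbar_pos hσ hP gσ ε₁_pos ε₂_pos hρ'
    · exact le_iSup₂ (f := fun ρ (_ : ρ ∈ thresholdStates hbar n ε₁ ε₂) =>
        errorFunction hbar ρ (phaseSpaceObservable hbar σ)) ρ hmem
    · rw [he, EReal.coe_ennreal_ofReal, max_eq_left hn]
  · have hδ : 0 < hbar ^ 2 / (4 * ε₁) := by positivity
    refine ⟨exists_isGaussianState_var hbar_pos ε₁_pos le_rfl, fun ρ hg h1 h2 => ?_⟩
    -- The position threshold is met with equality; for momentum the case hypothesis gives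
    -- $\hbar^2/(4\varepsilon_1)>\varepsilon_2$.
    have hmem : ρ ∈ thresholdStates hbar n ε₁ ε₂ := by
      refine ⟨hg, by rw [h1, sub_self]; exact Matrix.PosSemidef.zero, ?_⟩
      rw [h2, ← sub_smul]
      refine Matrix.PosSemidef.one.smul (sub_nonneg.2 ?_)
      rw [le_div_iff₀ (by positivity)]
      linarith
    obtain ⟨hn, he⟩ := errorFunction_eq hbar_pos hσ hP gσ ε₁_pos hδ hg h1 h2
    refine ⟨hmem, ?_, ?_⟩
    · exact le_iSup₂ (f := fun ρ (_ : ρ ∈ thresholdStates hbar n ε₁ ε₂) =>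
        errorFunction hbar ρ (phaseSpaceObservable hbar σ)) ρ hmem
    · rw [he, EReal.coe_ennreal_ofReal, max_eq_left hn]
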